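/- Consider the problem of minimizing $f(x)$ over $x\in\mathbb R^n$ subject to $c_i(x)=0$ $(i\in\mathcal E)$ and $c_i(x)\ge 0$ $(i\in\mathcal I)$, with finite index sets, $m=|\mathcal E|+|\mathcal I|$, and feasible set $\Omega$. **Data.** Let $D\subset\mathbb R^n$ be compact and convex with $\Omega\subseteq D$, and let $O\supseteq D$ be open. The function $f$ is Lipschitz continuous and upper-$C^2$ on $O$: near each point of $O$ it can be written as $f(x)=\min_{t\in T}p(t,x)$ with $T$ compact, where $p(t,\cdot)$ is $C^2$ and $p$ and its $x$-derivatives up to order two are jointly continuous. The constant $\rho>0$ is such that $-f+\frac{\rho}{2}\|\cdot\|^2$ is convex on $D$. All $c_i$ are $C^2$, and $H\ge 0$ satisfies $|c_i(x')-c_i(x)-\nabla c_i(x)^T(x'-x)|\le \frac H2\|x'-x\|^2$ for all $x,x'\in D$ and all $i$. Put $c_h=mH$. **Algorithm.** Let $v(x)=\sum_{\mathcal E}|c_i(x)|+\sum_{\mathcal I}\max\{0,-c_i(x)\}$ and $\phi(x,\theta)=f(x)+\theta v(x)$, let $\eta,\tau\in(0,1)$, $\gamma>0$, $\theta_0>0$,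 and let $x_0$ be given. For $k=0,1,2,\dots$, choose $g_k$ in the Clarke subdifferential $\bar\partial f(x_k)$ and a symmetric matrix $B_k$. Let $(d_k,v^k,w^k,t^k)$ be a solution of $$\min_{d,v,w,t}\ f(x_k)+g_k^Td+\tfrac12 d^TB_kd+\theta_k\sum_{i\in\mathcal E}(v_i+w_i)+\theta_k\sum_{i\in\mathcal I}t_i$$ subject to $c_i(x_k)+\nabla c_i(x_k)^Td=v_i-w_i$ $(i\in\mathcal E)$, $c_i(x_k)+\nabla c_i(x_k)^Td\ge -t_i$ $(i\in\mathcal I)$, and $v,w,t\ge 0$, and let $\lambda^{k+1}\in\mathbb R^m$ be Lagrange multipliers of its linearized constraints. Set $\theta_{k+1}=\max\{\theta_k,\|\lambda^{k+1}\|_\infty+\gamma\}$. Let $\alpha_k$ be the first number in $1,\tau,\tau^2,\dots$ for which $\phi(x_k,\theta_k)-\phi(x_k+\alpha_kd_k,\theta_k)\ge\frac12\eta\,\alpha_k d_k^TB_kd_k$, and set $x_{k+1}=x_k+\alpha_kd_k$. The stopping test is used with zero tolerances, and the run is infinite. **Assumptions on the run.** For all $k$, $x_k\in D$ and $x_k+d_k\in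 D$. The matrices $B_k$ are bounded, and $d^TB_kd\ge b\|d\|^2$ for all $d$ and $k$. At every accumulation point $x$ of $\{x_k\}$ the Mangasarian–Fromovitz condition holds: the gradients $\nabla c_i(x)$, $i\in\mathcal E$, are linearly independent, and some $w$ satisfies $\nabla c_i(x)^Tw=0$ for $i\in\mathcal E$ and $\nabla c_i(x)^Tw>0$ for all $i\in\mathcal I$ with $c_i(x)\le 0$ (that is, for the active inequalities when $x$ is feasible). **Potential function.** For constants $\sigma,l$ let $F=-f+\frac\sigma2\|\cdot\|^2$ on $D$ and $F=+\infty$ off $D$, let $F^*$ be its conjugate, and let $$L(x,y,w)=-y^Tx+F^*(y)+\tfrac\sigma2\|x\|^2+\tfrac l2\|x-w\|^2+i_{\bar C}(x,w),$$ where $i_{\bar C}$ is the $0/{+\infty}$ indicator function of the set $\bar C$ of pairs $(x,w)$ with $c_i(w)+\nabla c_i(w)^T(x-w)=0$ for $i\in\mathcal E$ and $\ge0$ for $i\in\mathcal I$. Assume that $L$ is a KL function: with $\partial L$ the limiting subdifferential, for each $\hat z$ with $\partial L(\hat z)\neq\emptyset$ there are $\epsilon\in(0,\infty]$, a neighborhood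 $U$ of $\hat z$, and a continuous concave $\varphi:[0,\epsilon)\to[0,\infty)$ with $\varphi(0)=0$, which is $C^1$ with $\varphi'>0$ on $(0,\epsilon)$, such that $\varphi'(L(z)-L(\hat z))\,\mathrm{dist}(0,\partial L(z))\ge1$ for all $z\in U$ with $L(\hat z)<L(z)<L(\hat z)+\epsilon$ (where $\mathrm{dist}(0,\emptyset)=+\infty$). **Claim.** Let $c_b\in(0,1)$ satisfy $c_b\,b\ge\theta_k c_h$ for all sufficiently large $k$, and let $2b\ge l+\sigma$, $l/c_b>b\ge\sigma\ge\rho$ and $\eta\le 1-c_b$. Then the full sequence $\{x_k\}$ converges to a point $\bar x$ that is a KKT point: there is $\bar\lambda\in\mathbb R^m$ with $0\in\bar\partial f(\bar x)-\sum_i\bar\lambda_i\nabla c_i(\bar x)$, $c_i(\bar x)=0$ for $i\in\mathcal E$, and $c_i(\bar x)\ge0$, $\bar\lambda_i\ge0$, $\bar\lambda_ic_i(\bar x)=0$ for $i\in\mathcal I$. Moreover, $\alpha_k=1$ for all sufficiently large $k$. -/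

import Mathlib

open Filter Topology Set
open scoped NNReal

noncomputable section

/-- Euclidean space `ℝⁿ`. -/
abbrev Sp (n : ℕ) : Type := EuclideanSpace ℝ (Fin n)

/-! ## Nonsmooth analysis -/

/-- The Clarke subdifferential: all `g` with `⟨g, v⟩ ≤ f°(x; v)` for every direction `v`, where
`f°(x; v) = limsup_{y → x, t ↓ 0} (f (y + t v) - f y) / t`. -/
def clarkeSubdiff {n : ℕ} (f : Sp n → ℝ) (x : Sp n) : Set (Sp n) :=
  {g | ∀ v : Sp n, ((inner ℝ g v : ℝ) : EReal) ≤
    limsup (fun q : Sp n × ℝ => (((f (q.1 + q.2 • v) - f q.1) / q.2 : ℝ) : EReal))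
      (𝓝 x ×ˢ 𝓝[>] (0 : ℝ))}

/-- `f` is upper-`C²` on the open set `O`: near each point of `O` it is a minimum
`f x = min_{t ∈ T} p t x` over a compact space `T`, where every `p t` is `C²` and `p` and its
partial derivatives in `x` up to order two are jointly continuous in `(t, x)`. -/
def UpperC2On {n : ℕ} (f : Sp n → ℝ) (O : Set (Sp n)) : Prop :=
  ∀ x₀ ∈ O, ∃ V : Set (Sp n), IsOpen V ∧ x₀ ∈ V ∧ V ⊆ O ∧
    ∃ (T : Type) (_ : TopologicalSpace T) (_ : CompactSpace T) (p : T → Sp n → ℝ),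
      (∀ t, ContDiffOn ℝ 2 (p t) V) ∧
      ContinuousOn (fun q : T × Sp n => p q.1 q.2) (univ ×ˢ V) ∧
      ContinuousOn (fun q : T × Sp n => fderiv ℝ (p q.1) q.2) (univ ×ˢ V) ∧
      ContinuousOn (fun q : T × Sp n => fderiv ℝ (fderiv ℝ (p q.1)) q.2) (univ ×ˢ V) ∧
      ∀ x ∈ V, IsLeast (range fun t => p t x) (f x)

section Subdifferential

variable {V : Type*} [NormedAddCommGroup V] [InnerProductSpace ℝ V]

/-- The (lower) regular subdifferential of an extended real valued function at a point where it is
finite: `h x ≥ h x₀ + ⟨v, x - x₀⟩ - o(‖x - x₀‖)`. It is empty where `h` is not finite. -/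
def regSubdiff (h : V → EReal) (x₀ : V) : Set V :=
  {v | h x₀ ≠ ⊤ ∧ h x₀ ≠ ⊥ ∧ ∀ ε : ℝ, 0 < ε → ∀ᶠ x in 𝓝 x₀,
    (((h x₀).toReal + inner ℝ v (x - x₀) - ε * ‖x - x₀‖ : ℝ) : EReal) ≤ h x}

/-- The (lower) general, or limiting, subdifferential: limits of regular subgradients `u k` at
points `y k → x₀` with `h (y k) → h x₀`. -/
def limSubdiff (h : V → EReal) (x₀ : V) : Set V :=
  {v | h x₀ ≠ ⊤ ∧ h x₀ ≠ ⊥ ∧ ∃ y u : ℕ → V,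
    Tendsto y atTop (𝓝 x₀) ∧ Tendsto (fun k => h (y k)) atTop (𝓝 (h x₀)) ∧
    (∀ k, u k ∈ regSubdiff h (y k)) ∧ Tendsto u atTop (𝓝 v)}

/-- The domain of the general subdifferential. -/
def domSubdiff (h : V → EReal) : Set V := {x | (limSubdiff h x).Nonempty}

/-- The Kurdyka-Łojasiewicz property at `x₀`. The width `η` may be taken finite, since the
property passes to smaller widths. The distance to the empty set is `∞`. -/
def KLPropertyAt (h : V → EReal) (x₀ : V) : Prop :=
  ∃ η : ℝ, 0 < η ∧ ∃ U ∈ 𝓝 x₀, ∃ φ : ℝ → ℝ,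
    ContinuousOn φ (Ico 0 η) ∧ ConcaveOn ℝ (Ico 0 η) φ ∧ (∀ s ∈ Ico 0 η, 0 ≤ φ s) ∧
    φ 0 = 0 ∧ ContDiffOn ℝ 1 φ (Ioo 0 η) ∧ (∀ s ∈ Ioo 0 η, 0 < deriv φ s) ∧
    ∀ x ∈ U, h x₀ < h x → h x < h x₀ + (η : EReal) →
      1 ≤ ENNReal.ofReal (deriv φ ((h x).toReal - (h x₀).toReal)) *
        Metric.infEDist (0 : V) (limSubdiff h x)

/-- A KL function has the KL property at every point of the domain of its subdifferential. -/
def IsKLFunction (h : V → EReal) : Prop := ∀ x₀ ∈ domSubdiff h, KLPropertyAt h x₀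

/-- The conjugate function `h* u = sup_x (⟨u, x⟩ - h x)`. -/
def conjugateFun (h : V → EReal) (u : V) : EReal :=
  ⨆ x : V, (((inner ℝ u x : ℝ) : EReal) - h x)

open Classical in
/-- The indicator function, `0` on `C` and `+∞` off `C`. -/
def indicatorFun {X : Type*} (C : Set X) (x : X) : EReal := if x ∈ C then 0 else ⊤

end Subdifferential

/-! ## The constrained problem -/

/-- Minimize `f x` subject to `cE i x = 0` and `cI i x ≥ 0`. -/
structure Problem (n mE mI : ℕ) where
  f : Sp n → ℝ
  cE : Fin mE → Sp n → ℝ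
  cI : Fin mI → Sp n → ℝ

namespace Problem

variable {n mE mI : ℕ} (P : Problem n mE mI)

/-- The feasible region. -/
def feasibleSet : Set (Sp n) := {x | (∀ i, P.cE i x = 0) ∧ ∀ i, 0 ≤ P.cI i x}

/-- First-order (KKT) points of the problem, with the Clarke subdifferential of `f`. -/
def IsKKT (x : Sp n) : Prop :=
  ∃ (lE : Fin mE → ℝ) (lI : Fin mI → ℝ),
    (∃ g ∈ clarkeSubdiff P.f x,
      g - (∑ i, lE i • gradient (P.cE i) x + ∑ i, lI i • gradient (P.cI i) x) = 0) ∧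
    (∀ i, P.cE i x = 0) ∧
    (∀ i, lI i * P.cI i x = 0 ∧ 0 ≤ P.cI i x) ∧
    (∀ i, 0 ≤ lI i)

/-- The Mangasarian-Fromovitz constraint qualification at `x`. At a feasible `x` the condition
`cI i x ≤ 0` says that `i` is active; at an infeasible `x` it also selects the violated
inequalities. -/
def MFCQ (x : Sp n) : Prop :=
  LinearIndependent ℝ (fun i => gradient (P.cE i) x) ∧
  ∃ w : Sp n, (∀ i, P.cI i x ≤ 0 → 0 < inner ℝ (gradient (P.cI i) x) w) ∧
    ∀ i, inner ℝ (gradient (P.cE i) x) w = 0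

/-- The constraint violation `∑ |cE i x| + ∑ max 0 (-cI i x)`. -/
def violation (x : Sp n) : ℝ := ∑ i, |P.cE i x| + ∑ i, max 0 (-(P.cI i x))

/-- The `ℓ₁` merit function. -/
def merit (x : Sp n) (θ : ℝ) : ℝ := P.f x + θ * P.violation x

/-- The linearization `c w + ⟨∇c w, x - w⟩` at `w`. -/
def linearized (c : Sp n → ℝ) (x w : Sp n) : ℝ := c w + inner ℝ (gradient c w) (x - w)

/-- The set of pairs `(x, w)` such that `x` satisfies the constraints linearized at `w`. -/
def linFeasible : Set (Sp n × Sp n) :=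
  {q | (∀ i, linearized (P.cE i) q.1 q.2 = 0) ∧ ∀ i, 0 ≤ linearized (P.cI i) q.1 q.2}

open Classical in
/-- The function `F = -f + (σ/2)‖·‖²` on `D`, and `+∞` off `D`. -/
def dcFun (D : Set (Sp n)) (σ : ℝ) (x : Sp n) : EReal :=
  if x ∈ D then ((-(P.f x) + σ / 2 * ‖x‖ ^ 2 : ℝ) : EReal) else ⊤

/-- The potential function
`L (x, y, w) = -⟨y, x⟩ + F* y + (σ/2)‖x‖² + (l/2)‖x - w‖² + i_C (x, w)` on `ℝⁿ × ℝⁿ × ℝⁿ` with its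
Euclidean norm; `x`, `y`, `w` are the components `0`, `1`, `2` of `z`. -/
def potential (D : Set (Sp n)) (σ l : ℝ) (z : PiLp 2 (fun _ : Fin 3 => Sp n)) : EReal :=
  ((-(inner ℝ (z 1) (z 0)) + σ / 2 * ‖z 0‖ ^ 2 + l / 2 * ‖z 0 - z 2‖ ^ 2 : ℝ) : EReal)
    + conjugateFun (P.dcFun D σ) (z 1)
    + indicatorFun P.linFeasible (z 0, z 2)

/-- The objective of the relaxed quadratic subproblem at `x`, in the step `d` and the slack
variables `v`, `w`, `t`. -/
def subObj (x g : Sp n) (B : Sp n →L[ℝ] Sp n) (θ : ℝ)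
    (d : Sp n) (v w : Fin mE → ℝ) (t : Fin mI → ℝ) : ℝ :=
  P.f x + inner ℝ g d + 1 / 2 * inner ℝ d (B d) + θ * ∑ i, (v i + w i) + θ * ∑ i, t i

/-- Feasibility for the relaxed subproblem at `x`. -/
def SubFeasible (x d : Sp n) (v w : Fin mE → ℝ) (t : Fin mI → ℝ) : Prop :=
  (∀ i, P.cE i x + inner ℝ (gradient (P.cE i) x) d = v i - w i) ∧
  (∀ i, -t i ≤ P.cI i x + inner ℝ (gradient (P.cI i) x) d) ∧
  (∀ i, 0 ≤ v i) ∧ (∀ i, 0 ≤ w i) ∧ ∀ i, 0 ≤ t i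

/-- `(d, v, w, t)` is a solution of the relaxed subproblem at `x`. -/
def SubSolution (x g : Sp n) (B : Sp n →L[ℝ] Sp n) (θ : ℝ)
    (d : Sp n) (v w : Fin mE → ℝ) (t : Fin mI → ℝ) : Prop :=
  P.SubFeasible x d v w t ∧
  ∀ d' v' w' t', P.SubFeasible x d' v' w' t' →
    P.subObj x g B θ d v w t ≤ P.subObj x g B θ d' v' w' t'

/-- `(lE, lI)` are Lagrange multipliers of the linearized constraints at the point `(d, v, w, t)`
of the relaxed subproblem; `p`, `q`, `r` are the multipliers of the bounds on `v`, `w`, `t`. -/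
def SubMultiplier (x g : Sp n) (B : Sp n →L[ℝ] Sp n) (θ : ℝ)
    (d : Sp n) (v w : Fin mE → ℝ) (t : Fin mI → ℝ) (lE : Fin mE → ℝ) (lI : Fin mI → ℝ) : Prop :=
  g + B d - (∑ i, lE i • gradient (P.cE i) x + ∑ i, lI i • gradient (P.cI i) x) = 0 ∧
  (∀ i, lI i * (P.cI i x + inner ℝ (gradient (P.cI i) x) d + t i) = 0) ∧
  (∀ i, 0 ≤ lI i) ∧
  ∃ (p q : Fin mE → ℝ) (r : Fin mI → ℝ),
    (∀ i, θ + lE i - p i = 0) ∧ (∀ i, θ - lE i - q i = 0) ∧ (∀ i, θ - lI i - r i = 0) ∧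
    (∀ i, p i * v i = 0) ∧ (∀ i, q i * w i = 0) ∧ (∀ i, r i * t i = 0) ∧
    (∀ i, 0 ≤ p i) ∧ (∀ i, 0 ≤ q i) ∧ ∀ i, 0 ≤ r i

/-- The line search condition for the step size `a`. -/
def LineSearchCond (η θ : ℝ) (x d : Sp n) (B : Sp n →L[ℝ] Sp n) (a : ℝ) : Prop :=
  η * a * (1 / 2 * inner ℝ d (B d)) ≤ P.merit x θ - P.merit (x + a • d) θ

end Problem

/-! ## The algorithm -/

/-- The quantities produced by the algorithm: iterates `x k`, subgradients `g k`, matrices `B k`,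
penalty parameters `θ k`, step sizes `α k`, subproblem solutions `(d k, v k, w k, t k)`, and
multipliers `lE k`, `lI k` (the multiplier with index `k + 1`, obtained in iteration `k`). -/
structure Iterates (n mE mI : ℕ) where
  x : ℕ → Sp n
  g : ℕ → Sp n
  B : ℕ → Sp n →L[ℝ] Sp n
  θ : ℕ → ℝ
  α : ℕ → ℝ
  d : ℕ → Sp n
  v : ℕ → Fin mE → ℝ
  w : ℕ → Fin mE → ℝ
  t : ℕ → Fin mI → ℝ
  lE : ℕ → Fin mE → ℝ
  lI : ℕ → Fin mI → ℝ

/-- `s` is an infinite run of the line search SQP method with line search coefficient `η`,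
backtracking factor `τ` and penalty increment `γ`. The norm on `Fin m → ℝ` is the maximum norm.
Nothing is asked about the stopping test, so every run in which it never fires is included.
The matrices `B k` may be chosen by any rule. -/
structure IsSQPRun {n mE mI : ℕ} (P : Problem n mE mI) (η τ γ : ℝ) (s : Iterates n mE mI) :
    Prop where
  theta_zero_pos : 0 < s.θ 0
  subgradient : ∀ k, s.g k ∈ clarkeSubdiff P.f (s.x k)
  solution : ∀ k, P.SubSolution (s.x k) (s.g k) (s.B k) (s.θ k) (s.d k) (s.v k) (s.w k) (s.t k)
  multiplier : ∀ k, P.SubMultiplier (s.x k) (s.g k) (s.B k) (s.θ k) (s.d k) (s.v k) (s.w k) (s.t k)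
    (s.lE k) (s.lI k)
  penalty : ∀ k, s.θ (k + 1) = max (s.θ k) (max ‖s.lE k‖ ‖s.lI k‖ + γ)
  lineSearch : ∀ k, ∃ j : ℕ, s.α k = τ ^ j ∧
    P.LineSearchCond η (s.θ k) (s.x k) (s.d k) (s.B k) (τ ^ j) ∧
    ∀ i < j, ¬ P.LineSearchCond η (s.θ k) (s.x k) (s.d k) (s.B k) (τ ^ i)
  step : ∀ k, s.x (k + 1) = s.x k + s.α k • s.d k

end

/-! A Clarke subgradient of an upper-C² function is the slope of a quadratic upper model: f(y) ≤
f(x) + ⟨g, y − x⟩ + (ρ/2)‖y − x‖² on D (`clarkeSubdiff.le_add_of_convexOn`). In the subproblem the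
multipliers are bounded by θ_k, so the penalty dominates the Lagrangian terms. Together these facts
give, once θ_k c_h ≤ c_b b, a merit decrease of at least (1 − c_b)/2 · ⟨d, Bd⟩ along the full step
(`Problem.merit_decrease`). Since η ≤ 1 − c_b, the unit step is then accepted.

The penalty parameters stay bounded. If c_h > 0 this is the bound θ_k c_h ≤ c_b b itself. If c_h =
0, divergence would make the scaled multipliers λ/θ accumulate at a nonzero abnormal multiplier,
which MFCQ excludes (`not_tendsto_theta`). Hence d_k → 0 by telescoping. The increments of θ_k also
fall below γ, which forces ‖λ‖∞ < θ_k, so the slacks vanish and x_k + d_k satisfies the constraints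
linearized at x_k.

From then on the potential at (x_k + d_k, σx_k − g_k, x_k) equals f(x_k) + ⟨g_k, d_k⟩ + (σ + l)/2 ·
‖d_k‖², by equality in Fenchel–Young. It drops by at least a fixed multiple of ‖d_k‖²
(`eventually_potential_decrease`) and has a limiting subgradient of norm O(‖d_k‖)
(`Problem.exists_mem_limSubdiff_potential`). The KL inequality turns this into Σ‖d_k‖ < ∞
(`summable_of_KLPropertyAt`), so the iterates are Cauchy, and the KKT conditions pass to the limit
(`kkt_of_subseq`). -/

/-! ### Clarke subgradients of upper-C² functions -/

/-- The member p t active at z majorizes f and touches it at z, so its Taylor expansion is an upper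
model. Compactness of T and of a closed ball bounds the second derivatives, so M depends neither on
z nor on t. -/
theorem UpperC2On.exists_local_upper_model {n : ℕ} {f : Sp n → ℝ} {O : Set (Sp n)}
    (hf : UpperC2On f O) {x : Sp n} (hx : x ∈ O) :
    ∃ r > 0, Metric.ball x r ⊆ O ∧ ∃ M : ℝ, ∀ z ∈ Metric.ball x r, ∃ u : Sp n →L[ℝ] ℝ,
      ∀ y ∈ Metric.ball x r, f y ≤ f z + u (y - z) + M * ‖y - z‖ ^ 2 := by
  obtain ⟨V, hV, hxV, hVO, T, _, _, p, hp2, -, -, hpc, hmin⟩ := hf x hx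
  obtain ⟨r, hr, hrV⟩ := Metric.nhds_basis_closedBall.mem_iff.1 (hV.mem_nhds hxV)
  have hbV : Metric.ball x r ⊆ V := Metric.ball_subset_closedBall.trans hrV
  obtain ⟨M, hM⟩ := (isCompact_univ.prod (isCompact_closedBall x r)).exists_bound_of_continuousOn
    (E := Sp n →L[ℝ] Sp n →L[ℝ] ℝ) (f := fun q : T × Sp n => fderiv ℝ (fderiv ℝ (p q.1)) q.2)
    (hpc.mono (prod_mono_right hrV))
  refine ⟨r, hr, hbV.trans hVO, M, fun z hz => ?_⟩
  obtain ⟨t, ht⟩ := (hmin z (hbV hz)).1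
  refine ⟨fderiv ℝ (p t) z, fun y hy => ?_⟩
  have hlip : ∀ ξ ∈ Metric.ball x r,
      ‖fderiv ℝ (p t) ξ - fderiv ℝ (p t) z‖ ≤ M * ‖ξ - z‖ := fun ξ hξ =>
    (convex_ball x r).norm_image_sub_le_of_norm_fderiv_le (𝕜 := ℝ)
      (fun w hw => (((hp2 t).fderiv_of_isOpen hV (m := 1) (by norm_num)).differentiableOn
        (by norm_num)).differentiableAt (hV.mem_nhds (hbV hw)))
      (fun w hw => hM (t, w) ⟨mem_univ _, Metric.ball_subset_closedBall hw⟩) hz hξ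
  have hseg : segment ℝ z y ⊆ Metric.ball x r := (convex_ball x r).segment_subset hz hy
  have hM0 : 0 ≤ M := (norm_nonneg _).trans (hM (t, x) ⟨mem_univ _, by simp [hr.le]⟩)
  have key := (convex_segment z y).norm_image_sub_le_of_norm_hasFDerivWithin_le'
    (f := p t) (f' := fderiv ℝ (p t)) (φ := fderiv ℝ (p t) z) (C := M * ‖y - z‖)
    (fun ξ hξ => ((((hp2 t).differentiableOn (by norm_num)).differentiableAt
      (hV.mem_nhds (hbV (hseg hξ)))).hasFDerivAt).hasFDerivWithinAt)
    (fun ξ hξ => (hlip ξ (hseg hξ)).trans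
      (mul_le_mul_of_nonneg_left (by
        have := norm_sub_le_of_mem_segment hξ
        simpa [norm_sub_rev] using this) hM0))
    (left_mem_segment ℝ z y) (right_mem_segment ℝ z y)
  have h1 := (abs_le.1 (Real.norm_eq_abs _ ▸ key)).2
  have h2 : f y ≤ p t y := (hmin y (hbV hy)).2 ⟨t, rfl⟩
  have h3 : p t z = f z := ht
  nlinarith

/-- Upper models have slopes of their own; the point is that every Clarke subgradient serves as a
slope. Testing g against −v bounds ⟨g, v⟩ from below, which is the side needed. -/
theorem clarkeSubdiff.eventually_le {n : ℕ} {f : Sp n → ℝ} {O : Set (Sp n)} (hO : IsOpen O)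
    (hf : UpperC2On f O) (hc : ContinuousOn f O) {x g : Sp n} (hx : x ∈ O)
    (hg : g ∈ clarkeSubdiff f x) (v : Sp n) :
    ∃ M : ℝ, ∀ᶠ s in 𝓝[>] (0 : ℝ),
      f (x + s • v) ≤ f x + s * inner ℝ g v + M * s ^ 2 := by
  obtain ⟨r, hr, hrO, M, hM⟩ := hf.exists_local_upper_model hx
  refine ⟨M * ‖v‖ ^ 2, ?_⟩
  have hb : Metric.ball x r ∈ 𝓝 x := Metric.ball_mem_nhds x hr
  have hs : ∀ᶠ s in 𝓝[>] (0 : ℝ), x + s • v ∈ Metric.ball x r := by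
    have : Tendsto (fun s : ℝ => x + s • v) (𝓝[>] 0) (𝓝 x) := by
      have h : Continuous (fun s : ℝ => x + s • v) := by fun_prop
      simpa using (h.tendsto 0).mono_left nhdsWithin_le_nhds
    exact this hb
  filter_upwards [hs, self_mem_nhdsWithin] with s hs hs0
  have hs0 : 0 < s := hs0
  have hcx : ContinuousAt f x := hc.continuousAt (hO.mem_nhds hx)
  have hcs : ContinuousAt f (x + s • v) := hc.continuousAt (hO.mem_nhds (hrO hs))
  set L := 𝓝 x ×ˢ 𝓝[>] (0 : ℝ) with hL
  have t1 : Tendsto (fun q : Sp n × ℝ => q.1) L (𝓝 x) := tendsto_fst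
  have t2 : Tendsto (fun q : Sp n × ℝ => q.2) L (𝓝 0) :=
    tendsto_snd.mono_right nhdsWithin_le_nhds
  have t3 : Tendsto (fun q : Sp n × ℝ => q.1 + q.2 • -v) L (𝓝 x) := by
    simpa using t1.add (t2.smul_const (-v))
  have t4 : Tendsto (fun q : Sp n × ℝ => q.1 + s • v) L (𝓝 (x + s • v)) := t1.add_const _
  have t5 : Tendsto (fun q : Sp n × ℝ =>
      ((-((f (q.1 + s • v) - f q.1) / s) + M * s * ‖v‖ ^ 2 + M * q.2 * ‖v‖ ^ 2 : ℝ) : EReal)) L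
      (𝓝 ((-((f (x + s • v) - f x) / s) + M * s * ‖v‖ ^ 2 + M * 0 * ‖v‖ ^ 2 : ℝ) : EReal)) := by
    refine (continuous_coe_real_ereal.tendsto _).comp ?_
    exact ((((hcs.tendsto.comp t4).sub (hcx.tendsto.comp t1)).div_const s).neg.add_const _).add
      ((t2.const_mul M).mul_const _)
  -- The model at q.1 is used twice with one slope u: for the short step along −v and for the step
  -- of fixed length s along v. Adding the two estimates eliminates u.
  have hle : ∀ᶠ q in L, (((f (q.1 + q.2 • -v) - f q.1) / q.2 : ℝ) : EReal) ≤
      ((-((f (q.1 + s • v) - f q.1) / s) + M * s * ‖v‖ ^ 2 + M * q.2 * ‖v‖ ^ 2 : ℝ) : EReal) := by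
    have hpos : ∀ᶠ q in L, 0 < q.2 := tendsto_snd self_mem_nhdsWithin
    filter_upwards [t1 hb, t3 hb, t4 (Metric.isOpen_ball.mem_nhds hs), hpos] with q h1 h3 h4 hq
    obtain ⟨u, hu⟩ := hM q.1 h1
    have e3 := hu _ h3
    have e4 := hu _ h4
    simp only [add_sub_cancel_left, map_smul, map_neg, smul_eq_mul, norm_smul, norm_neg,
      Real.norm_eq_abs, mul_pow, sq_abs] at e3 e4
    refine EReal.coe_le_coe_iff.2 ?_
    have e5 : (f (q.1 + q.2 • -v) - f q.1) / q.2 ≤ -(u v) + M * q.2 * ‖v‖ ^ 2 := by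
      rw [div_le_iff₀ hq]; nlinarith
    have e6 : (f (q.1 + s • v) - f q.1) / s ≤ u v + M * s * ‖v‖ ^ 2 := by
      rw [div_le_iff₀ hs0]; nlinarith
    linarith
  have := (hg (-v)).trans ((limsup_le_limsup hle).trans t5.limsup_eq.le)
  rw [EReal.coe_le_coe_iff, inner_neg_right] at this
  have h6 : (f (x + s • v) - f x) / s ≤ inner ℝ g v + M * s * ‖v‖ ^ 2 := by linarith
  rw [div_le_iff₀ hs0] at h6
  nlinarith

/-- Convexity of −f + (ρ/2)‖·‖² on the segment bounds f(y) through f(x + s(y − x)), to which the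
directional estimate applies. After division by s, the local constant M enters only as Ms and
disappears as s ↓ 0, leaving ρ/2. -/
theorem clarkeSubdiff.le_add_of_convexOn {n : ℕ} {f : Sp n → ℝ} {D O : Set (Sp n)}
    (hO : IsOpen O) (hDO : D ⊆ O) (hf : UpperC2On f O) (hc : ContinuousOn f O) {ρ : ℝ}
    (hconv : ConvexOn ℝ D (fun x => -(f x) + 1 / 2 * ρ * ‖x‖ ^ 2)) {x y g : Sp n}
    (hx : x ∈ D) (hy : y ∈ D) (hg : g ∈ clarkeSubdiff f x) :
    f y ≤ f x + inner ℝ g (y - x) + ρ / 2 * ‖y - x‖ ^ 2 := by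
  obtain ⟨M, hM⟩ := clarkeSubdiff.eventually_le hO hf hc (hDO hx) hg (y - x)
  have hlt : ∀ᶠ s in 𝓝[>] (0 : ℝ), s < 1 := nhdsWithin_le_nhds (Iio_mem_nhds one_pos)
  have key : ∀ᶠ s in 𝓝[>] (0 : ℝ), f y ≤ f x + inner ℝ g (y - x) + M * s
      + ρ / 2 * ((1 - s) * ‖y - x‖ ^ 2) := by
    filter_upwards [hM, hlt, self_mem_nhdsWithin] with s h1 h2 h3
    have h3 : 0 < s := h3
    have hcv := hconv.2 hx hy (by linarith : 0 ≤ 1 - s) h3.le (by ring)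
    have e : (1 - s) • x + s • y = x + s • (y - x) := by
      rw [sub_smul, one_smul, smul_sub]; abel
    rw [e] at hcv
    simp only [smul_eq_mul] at hcv
    have n1 : ‖x + s • (y - x)‖ ^ 2 =
        ‖x‖ ^ 2 + 2 * (s * inner ℝ x (y - x)) + s ^ 2 * ‖y - x‖ ^ 2 := by
      rw [norm_add_sq_real, inner_smul_right, norm_smul, mul_pow, Real.norm_eq_abs, sq_abs]
    have n2 : ‖y‖ ^ 2 = ‖x‖ ^ 2 + 2 * inner ℝ x (y - x) + ‖y - x‖ ^ 2 := by
      rw [← norm_add_sq_real, add_sub_cancel]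
    rw [n1, n2] at hcv
    have : s * f y ≤ s * (f x + inner ℝ g (y - x) + M * s + ρ / 2 * ((1 - s) * ‖y - x‖ ^ 2)) := by
      linarith
    exact le_of_mul_le_mul_left this h3
  have hcont : Continuous fun s : ℝ => f x + inner ℝ g (y - x) + M * s
      + ρ / 2 * ((1 - s) * ‖y - x‖ ^ 2) := by fun_prop
  have := ge_of_tendsto ((hcont.tendsto 0).mono_left nhdsWithin_le_nhds) key
  simpa using this

theorem clarkeSubdiff.norm_le {n : ℕ} {f : Sp n → ℝ} {O : Set (Sp n)} (hO : IsOpen O) {K : ℝ≥0}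
    (hf : LipschitzOnWith K f O) {x g : Sp n} (hx : x ∈ O) (hg : g ∈ clarkeSubdiff f x) :
    ‖g‖ ≤ K := by
  have t1 : Tendsto (fun q : Sp n × ℝ => q.1) (𝓝 x ×ˢ 𝓝[>] (0 : ℝ)) (𝓝 x) := tendsto_fst
  have t2 : Tendsto (fun q : Sp n × ℝ => q.2) (𝓝 x ×ˢ 𝓝[>] (0 : ℝ)) (𝓝 0) :=
    tendsto_snd.mono_right nhdsWithin_le_nhds
  have t3 : Tendsto (fun q : Sp n × ℝ => q.1 + q.2 • g) (𝓝 x ×ˢ 𝓝[>] (0 : ℝ)) (𝓝 x) := by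
    simpa using t1.add (t2.smul_const g)
  have hpos : ∀ᶠ q in 𝓝 x ×ˢ 𝓝[>] (0 : ℝ), 0 < q.2 := tendsto_snd self_mem_nhdsWithin
  have h : limsup (fun q : Sp n × ℝ => (((f (q.1 + q.2 • g) - f q.1) / q.2 : ℝ) : EReal))
      (𝓝 x ×ˢ 𝓝[>] (0 : ℝ)) ≤ ((K * ‖g‖ : ℝ) : EReal) := by
    refine limsup_le_of_le (h := ?_)
    filter_upwards [t1 (hO.mem_nhds hx), t3 (hO.mem_nhds hx), hpos] with q h1 h3 hq
    refine EReal.coe_le_coe_iff.2 ?_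
    rw [div_le_iff₀ hq]
    have := hf.dist_le_mul _ h3 _ h1
    rw [Real.dist_eq, dist_eq_norm, add_sub_cancel_left, norm_smul, Real.norm_of_nonneg hq.le]
      at this
    linarith [le_abs_self (f (q.1 + q.2 • g) - f q.1)]
  have := (hg g).trans h
  rw [EReal.coe_le_coe_iff, real_inner_self_eq_norm_sq] at this
  by_contra! hK
  nlinarith [K.coe_nonneg]

/-- The generalized directional derivative is upper semicontinuous in the base point: a bound on the
difference quotients over a neighbourhood of x also serves at each X k inside it. -/
theorem clarkeSubdiff.mem_of_tendsto {n : ℕ} {f : Sp n → ℝ} {x g : Sp n} {X G : ℕ → Sp n}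
    (hX : Tendsto X atTop (𝓝 x)) (hG : Tendsto G atTop (𝓝 g))
    (h : ∀ k, G k ∈ clarkeSubdiff f (X k)) : g ∈ clarkeSubdiff f x := by
  intro v
  refine le_of_forall_gt fun r hr => ?_
  obtain ⟨r', hr', hr'r⟩ := exists_between hr
  refine lt_of_le_of_lt ?_ hr'r
  have hev := eventually_lt_of_limsup_lt hr'
  obtain ⟨U, hU, W, hW, hUW⟩ := mem_prod_iff.1 hev
  have hX' : ∀ᶠ k in atTop, ((inner ℝ (G k) v : ℝ) : EReal) ≤ r' := by
    filter_upwards [hX (interior_mem_nhds.2 hU)] with k hk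
    refine (h k v).trans (limsup_le_of_le (h := ?_))
    exact mem_of_superset (prod_mem_prod (mem_interior_iff_mem_nhds.1 hk) hW)
      fun q hq => le_of_lt (by simpa using hUW hq)
  exact le_of_tendsto ((continuous_coe_real_ereal.tendsto _).comp
    (hG.inner tendsto_const_nhds)) hX'

/-! ### Multipliers of the relaxed subproblem and decrease of the merit function -/

namespace Problem

variable {n mE mI : ℕ} {P : Problem n mE mI}

theorem SubMultiplier.abs_lE_le {x g d : Sp n} {B : Sp n →L[ℝ] Sp n} {θ : ℝ} {v w : Fin mE → ℝ}
    {t : Fin mI → ℝ} {lE : Fin mE → ℝ} {lI : Fin mI → ℝ}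
    (h : P.SubMultiplier x g B θ d v w t lE lI) (i : Fin mE) : |lE i| ≤ θ := by
  obtain ⟨-, -, -, p, q, r, hp, hq, -, -, -, -, hp0, hq0, -⟩ := h
  rw [abs_le]
  constructor <;> linarith [hp i, hq i, hp0 i, hq0 i]

theorem SubMultiplier.lI_nonneg {x g d : Sp n} {B : Sp n →L[ℝ] Sp n} {θ : ℝ} {v w : Fin mE → ℝ}
    {t : Fin mI → ℝ} {lE : Fin mE → ℝ} {lI : Fin mI → ℝ}
    (h : P.SubMultiplier x g B θ d v w t lE lI) (i : Fin mI) : 0 ≤ lI i := h.2.2.1 i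

theorem SubMultiplier.lI_le {x g d : Sp n} {B : Sp n →L[ℝ] Sp n} {θ : ℝ} {v w : Fin mE → ℝ}
    {t : Fin mI → ℝ} {lE : Fin mE → ℝ} {lI : Fin mI → ℝ}
    (h : P.SubMultiplier x g B θ d v w t lE lI) (i : Fin mI) : lI i ≤ θ := by
  obtain ⟨-, -, -, p, q, r, -, -, hr, -, -, -, -, -, hr0⟩ := h
  linarith [hr i, hr0 i]

/-- A positive slack has a zero bound multiplier, which pins the constraint multiplier to −θ (for v)
or θ (for w). -/
theorem SubMultiplier.lE_mul {x g d : Sp n} {B : Sp n →L[ℝ] Sp n} {θ : ℝ} {v w : Fin mE → ℝ}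
    {t : Fin mI → ℝ} {lE : Fin mE → ℝ} {lI : Fin mI → ℝ}
    (h : P.SubMultiplier x g B θ d v w t lE lI) (i : Fin mE) :
    lE i * v i = -(θ * v i) ∧ lE i * w i = θ * w i := by
  obtain ⟨-, -, -, p, q, r, hp, hq, -, hpv, hqw, -, -, -, -⟩ := h
  have h1 : p i = θ + lE i := by linarith [hp i]
  have h2 : q i = θ - lE i := by linarith [hq i]
  have h3 := hpv i
  have h4 := hqw i
  rw [h1] at h3
  rw [h2] at h4
  constructor <;> linarith

theorem SubMultiplier.lI_mul {x g d : Sp n} {B : Sp n →L[ℝ] Sp n} {θ : ℝ} {v w : Fin mE → ℝ}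
    {t : Fin mI → ℝ} {lE : Fin mE → ℝ} {lI : Fin mI → ℝ}
    (h : P.SubMultiplier x g B θ d v w t lE lI) (i : Fin mI) : lI i * t i = θ * t i := by
  obtain ⟨-, -, -, p, q, r, -, -, hr, -, -, hrt, -, -, -⟩ := h
  have h1 : r i = θ - lI i := by linarith [hr i]
  have h2 := hrt i
  rw [h1] at h2
  linarith

/-- The first-order condition of the subproblem in the direction of its solution. -/
theorem SubMultiplier.inner_add_eq {x g d : Sp n} {B : Sp n →L[ℝ] Sp n} {θ : ℝ}
    {v w : Fin mE → ℝ} {t : Fin mI → ℝ} {lE : Fin mE → ℝ} {lI : Fin mI → ℝ}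
    (h : P.SubMultiplier x g B θ d v w t lE lI) (hf : P.SubFeasible x d v w t) :
    inner ℝ g d + inner ℝ d (B d) + (∑ i, lE i * P.cE i x + ∑ i, lI i * P.cI i x) =
      -(θ * (∑ i, (v i + w i) + ∑ i, t i)) := by
  have h0 : inner ℝ (g + B d - (∑ i, lE i • gradient (P.cE i) x
      + ∑ i, lI i • gradient (P.cI i) x)) d = 0 := by rw [h.1, inner_zero_left]
  rw [inner_sub_left, inner_add_left, inner_add_left, sum_inner, sum_inner,
    real_inner_comm d (B d)] at h0
  simp only [inner_smul_left, RCLike.conj_to_real] at h0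
  have hE : ∑ i, lE i * inner ℝ (gradient (P.cE i) x) d + ∑ i, lE i * P.cE i x =
      -(θ * ∑ i, (v i + w i)) := by
    rw [← Finset.sum_add_distrib, Finset.mul_sum, ← Finset.sum_neg_distrib]
    refine Finset.sum_congr rfl fun i _ => ?_
    rw [← mul_add, add_comm, hf.1 i, mul_sub, (h.lE_mul i).1, (h.lE_mul i).2]
    ring
  have hI : ∑ i, lI i * inner ℝ (gradient (P.cI i) x) d + ∑ i, lI i * P.cI i x =
      -(θ * ∑ i, t i) := by
    rw [← Finset.sum_add_distrib, Finset.mul_sum, ← Finset.sum_neg_distrib]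
    refine Finset.sum_congr rfl fun i _ => ?_
    linarith [h.2.1 i, h.lI_mul i]
  linarith

theorem neg_le_mul_of_abs_le {θ a c : ℝ} (h : |a| ≤ θ) : -(θ * |c|) ≤ a * c := by
  have : |a * c| ≤ θ * |c| := by rw [abs_mul]; gcongr
  exact (abs_le.1 this).1

theorem neg_mul_max_le {θ a c : ℝ} (h0 : 0 ≤ a) (h : a ≤ θ) : -(θ * max 0 (-c)) ≤ a * c := by
  rcases le_total 0 (-c) with hc | hc
  · rw [max_eq_right hc]; nlinarith
  · rw [max_eq_left hc]; nlinarith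

/-- Exactness of the ℓ₁ penalty: multipliers of size at most θ, nonnegative on the inequalities,
cannot outweigh θ times the violation. The point y is arbitrary. -/
theorem SubMultiplier.neg_violation_le {x g d : Sp n} {B : Sp n →L[ℝ] Sp n} {θ : ℝ}
    {v w : Fin mE → ℝ} {t : Fin mI → ℝ} {lE : Fin mE → ℝ} {lI : Fin mI → ℝ}
    (h : P.SubMultiplier x g B θ d v w t lE lI) (y : Sp n) :
    -(θ * P.violation y) ≤ ∑ i, lE i * P.cE i y + ∑ i, lI i * P.cI i y := by
  rw [violation, mul_add, neg_add, Finset.mul_sum, Finset.mul_sum, ← Finset.sum_neg_distrib,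
    ← Finset.sum_neg_distrib]
  exact add_le_add (Finset.sum_le_sum fun i _ => neg_le_mul_of_abs_le (h.abs_lE_le i))
    (Finset.sum_le_sum fun i _ => neg_mul_max_le (h.lI_nonneg i) (h.lI_le i))

/-- The constraint violation after a full step is at most the slack of the subproblem plus the
linearization error. -/
theorem violation_add_le {D : Set (Sp n)} {H : ℝ}
    (hHE : ∀ i, ∀ x ∈ D, ∀ x' ∈ D,
      |P.cE i x' - P.cE i x - inner ℝ (gradient (P.cE i) x) (x' - x)| ≤ H / 2 * ‖x - x'‖ ^ 2)
    (hHI : ∀ i, ∀ x ∈ D, ∀ x' ∈ D,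
      |P.cI i x' - P.cI i x - inner ℝ (gradient (P.cI i) x) (x' - x)| ≤ H / 2 * ‖x - x'‖ ^ 2)
    {x d : Sp n} (hx : x ∈ D) (hd : x + d ∈ D) {v w : Fin mE → ℝ} {t : Fin mI → ℝ}
    (hf : P.SubFeasible x d v w t) :
    P.violation (x + d) ≤ (∑ i, (v i + w i) + ∑ i, t i)
      + ((mE + mI : ℕ) : ℝ) * H / 2 * ‖d‖ ^ 2 := by
  have hE : ∑ i, |P.cE i (x + d)| ≤ ∑ i, (v i + w i) + mE * (H / 2 * ‖d‖ ^ 2) := by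
    have : (mE : ℝ) * (H / 2 * ‖d‖ ^ 2) = ∑ _i : Fin mE, H / 2 * ‖d‖ ^ 2 := by simp
    rw [this, ← Finset.sum_add_distrib]
    refine Finset.sum_le_sum fun i _ => ?_
    have h1 := abs_le.1 (hHE i x hx _ hd)
    rw [sub_add_cancel_left, add_sub_cancel_left, norm_neg] at h1
    have h2 := hf.1 i
    have h3 := hf.2.2.1 i
    have h4 := hf.2.2.2.1 i
    rw [abs_le]
    constructor <;> linarith
  have hI : ∑ i, max 0 (-(P.cI i (x + d))) ≤ ∑ i, t i + mI * (H / 2 * ‖d‖ ^ 2) := by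
    have : (mI : ℝ) * (H / 2 * ‖d‖ ^ 2) = ∑ _i : Fin mI, H / 2 * ‖d‖ ^ 2 := by simp
    rw [this, ← Finset.sum_add_distrib]
    refine Finset.sum_le_sum fun i _ => ?_
    have h0 := (abs_nonneg _).trans (hHI i x hx _ hd)
    have h1 := abs_le.1 (hHI i x hx _ hd)
    rw [sub_add_cancel_left, norm_neg] at h0
    rw [sub_add_cancel_left, add_sub_cancel_left, norm_neg] at h1
    have h2 := hf.2.1 i
    have h3 := hf.2.2.2.2 i
    refine max_le ?_ ?_ <;> linarith
  rw [violation]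
  push_cast
  linarith

/-- The decrease of the merit function along a full step. -/
theorem merit_decrease {D O : Set (Sp n)} (hO : IsOpen O) (hDO : D ⊆ O)
    (hC2 : UpperC2On P.f O) (hc : ContinuousOn P.f O) {ρ : ℝ}
    (hconv : ConvexOn ℝ D (fun x => -(P.f x) + 1 / 2 * ρ * ‖x‖ ^ 2)) {H : ℝ}
    (hHE : ∀ i, ∀ x ∈ D, ∀ x' ∈ D,
      |P.cE i x' - P.cE i x - inner ℝ (gradient (P.cE i) x) (x' - x)| ≤ H / 2 * ‖x - x'‖ ^ 2)
    (hHI : ∀ i, ∀ x ∈ D, ∀ x' ∈ D,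
      |P.cI i x' - P.cI i x - inner ℝ (gradient (P.cI i) x) (x' - x)| ≤ H / 2 * ‖x - x'‖ ^ 2)
    {x g d : Sp n} {B : Sp n →L[ℝ] Sp n} {θ : ℝ}
    {v w : Fin mE → ℝ} {t : Fin mI → ℝ} {lE : Fin mE → ℝ} {lI : Fin mI → ℝ}
    (hx : x ∈ D) (hd : x + d ∈ D) (hg : g ∈ clarkeSubdiff P.f x) (hθ : 0 ≤ θ)
    (h : P.SubMultiplier x g B θ d v w t lE lI) (hf : P.SubFeasible x d v w t)
    {b c_b : ℝ} (hb : b * ‖d‖ ^ 2 ≤ inner ℝ d (B d)) (hρb : ρ ≤ b) (hcb : 0 ≤ c_b)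
    (hθb : θ * (((mE + mI : ℕ) : ℝ) * H) ≤ c_b * b) :
    (1 - c_b) / 2 * inner ℝ d (B d) ≤ P.merit x θ - P.merit (x + d) θ := by
  -- The total slack in `h2` cancels against the slack bound in `h4`. What remains is ⟨d, Bd⟩ minus
  -- (ρ/2)‖d‖² and the linearization error, which cost at most 1/2 and c_b/2 of ⟨d, Bd⟩.
  have h1 := clarkeSubdiff.le_add_of_convexOn hO hDO hC2 hc hconv hx hd hg
  rw [add_sub_cancel_left] at h1
  have h2 := h.inner_add_eq hf
  have h3 := h.neg_violation_le x
  have h4 := mul_le_mul_of_nonneg_left (violation_add_le hHE hHI hx hd hf) hθ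
  have h5 : θ * (((mE + mI : ℕ) : ℝ) * H) * ‖d‖ ^ 2 ≤ c_b * inner ℝ d (B d) :=
    (mul_le_mul_of_nonneg_right hθb (sq_nonneg _)).trans (by
      rw [mul_assoc]; exact mul_le_mul_of_nonneg_left hb hcb)
  have h6 : ρ * ‖d‖ ^ 2 ≤ inner ℝ d (B d) :=
    (mul_le_mul_of_nonneg_right hρb (sq_nonneg _)).trans hb
  rw [merit, merit]
  nlinarith

end Problem

/-! ### Constraint qualification and standing assumptions -/

theorem continuous_gradient_of_contDiff {n : ℕ} {c : Sp n → ℝ} (hc : ContDiff ℝ 2 c) :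
    Continuous (gradient c) :=
  (InnerProductSpace.toDual ℝ (Sp n)).symm.continuous.comp (hc.continuous_fderiv (by norm_num))

namespace Problem

/-- Under the Mangasarian-Fromovitz condition there are no nontrivial abnormal multipliers. -/
theorem MFCQ.multiplier_eq_zero {n mE mI : ℕ} {P : Problem n mE mI} {x : Sp n} (h : P.MFCQ x)
    {lE : Fin mE → ℝ} {lI : Fin mI → ℝ}
    (hsum : ∑ i, lE i • gradient (P.cE i) x + ∑ i, lI i • gradient (P.cI i) x = 0)
    (h0 : ∀ i, 0 ≤ lI i) (hact : ∀ i, 0 < P.cI i x → lI i = 0) : lE = 0 ∧ lI = 0 := by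
  obtain ⟨hli, w, hwI, hwE⟩ := h
  have hI : lI = 0 := by
    have h1 : inner ℝ (∑ i, lE i • gradient (P.cE i) x + ∑ i, lI i • gradient (P.cI i) x) w = 0 := by
      rw [hsum, inner_zero_left]
    rw [inner_add_left, sum_inner, sum_inner] at h1
    simp only [inner_smul_left, RCLike.conj_to_real, hwE, mul_zero, Finset.sum_const_zero,
      zero_add] at h1
    have hnn : ∀ i ∈ Finset.univ, 0 ≤ lI i * inner ℝ (gradient (P.cI i) x) w := fun i _ => by
      rcases lt_or_ge 0 (P.cI i x) with hi | hi
      · simp [hact i hi]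
      · exact mul_nonneg (h0 i) (hwI i hi).le
    funext i
    rcases lt_or_ge 0 (P.cI i x) with hi | hi
    · exact hact i hi
    · exact (mul_eq_zero.1 ((Finset.sum_eq_zero_iff_of_nonneg hnn).1 h1 i (Finset.mem_univ i))
        ).resolve_right (hwI i hi).ne'
  refine ⟨?_, hI⟩
  subst hI
  simp only [Pi.zero_apply, zero_smul, Finset.sum_const_zero, add_zero] at hsum
  exact funext (Fintype.linearIndependent_iff.1 hli lE hsum)

end Problem

/-- The data, the algorithm and the assumptions on its run, without those on the potential
function. -/
structure SQPAssumptions {n mE mI : ℕ} (P : Problem n mE mI) (D O : Set (Sp n)) (K : ℝ≥0)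
    (ρ H η τ γ : ℝ) (s : Iterates n mE mI) (b c_b M : ℝ) : Prop where
  isOpen : IsOpen O
  subset : D ⊆ O
  isCompact : IsCompact D
  lipschitz : LipschitzOnWith K P.f O
  upperC2 : UpperC2On P.f O
  convexOn : ConvexOn ℝ D (fun x => -(P.f x) + 1 / 2 * ρ * ‖x‖ ^ 2)
  rho_pos : 0 < ρ
  contDiff_cE : ∀ i, ContDiff ℝ 2 (P.cE i)
  contDiff_cI : ∀ i, ContDiff ℝ 2 (P.cI i)
  H_nonneg : 0 ≤ H
  abs_cE : ∀ i, ∀ x ∈ D, ∀ x' ∈ D,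
    |P.cE i x' - P.cE i x - inner ℝ (gradient (P.cE i) x) (x' - x)| ≤ H / 2 * ‖x - x'‖ ^ 2
  abs_cI : ∀ i, ∀ x ∈ D, ∀ x' ∈ D,
    |P.cI i x' - P.cI i x - inner ℝ (gradient (P.cI i) x) (x' - x)| ≤ H / 2 * ‖x - x'‖ ^ 2
  gamma_pos : 0 < γ
  run : IsSQPRun P η τ γ s
  mem : ∀ k, s.x k ∈ D
  add_mem : ∀ k, s.x k + s.d k ∈ D
  norm_B_le : ∀ k, ‖s.B k‖ ≤ M
  le_B : ∀ k, ∀ d : Sp n, b * ‖d‖ ^ 2 ≤ inner ℝ d (s.B k d)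
  mfcq : ∀ x' : Sp n, MapClusterPt x' atTop s.x → P.MFCQ x'
  cb_pos : 0 < c_b
  cb_lt : c_b < 1
  eta_le : η ≤ 1 - c_b
  theta_le : ∀ᶠ k in atTop, s.θ k * (((mE + mI : ℕ) : ℝ) * H) ≤ c_b * b
  rho_le : ρ ≤ b

/-! ### Full steps and boundedness of the penalty parameters -/

namespace SQPAssumptions

variable {n mE mI : ℕ} {P : Problem n mE mI} {D O : Set (Sp n)} {K : ℝ≥0}
    {ρ H η τ γ : ℝ} {s : Iterates n mE mI} {b c_b M : ℝ}

theorem b_pos (h : SQPAssumptions P D O K ρ H η τ γ s b c_b M) : 0 < b :=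
  h.rho_pos.trans_le h.rho_le

theorem continuousOn_f (h : SQPAssumptions P D O K ρ H η τ γ s b c_b M) : ContinuousOn P.f O :=
  h.lipschitz.continuousOn

theorem monotone_theta (h : SQPAssumptions P D O K ρ H η τ γ s b c_b M) : Monotone s.θ :=
  monotone_nat_of_le_succ fun k => by rw [h.run.penalty k]; exact le_max_left _ _

theorem theta_pos (h : SQPAssumptions P D O K ρ H η τ γ s b c_b M) (k : ℕ) : 0 < s.θ k :=
  h.run.theta_zero_pos.trans_le (h.monotone_theta k.zero_le)

theorem le_inner_B (h : SQPAssumptions P D O K ρ H η τ γ s b c_b M) (k : ℕ) :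
    b * ‖s.d k‖ ^ 2 ≤ inner ℝ (s.d k) (s.B k (s.d k)) := h.le_B k _

theorem inner_B_nonneg (h : SQPAssumptions P D O K ρ H η τ γ s b c_b M) (k : ℕ) :
    0 ≤ inner ℝ (s.d k) (s.B k (s.d k)) :=
  (mul_nonneg h.b_pos.le (sq_nonneg _)).trans (h.le_inner_B k)

theorem norm_g_le (h : SQPAssumptions P D O K ρ H η τ γ s b c_b M) (k : ℕ) : ‖s.g k‖ ≤ K :=
  clarkeSubdiff.norm_le h.isOpen h.lipschitz (h.subset (h.mem k)) (h.run.subgradient k)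

theorem exists_norm_d_le (h : SQPAssumptions P D O K ρ H η τ γ s b c_b M) :
    ∃ R : ℝ, ∀ k, ‖s.d k‖ ≤ R := by
  obtain ⟨R, hR⟩ := h.isCompact.isBounded.exists_norm_le
  refine ⟨R + R, fun k => ?_⟩
  have := norm_sub_le (s.x k + s.d k) (s.x k)
  rw [add_sub_cancel_left] at this
  exact this.trans (add_le_add (hR _ (h.add_mem k)) (hR _ (h.mem k)))

theorem norm_B_apply_le (h : SQPAssumptions P D O K ρ H η τ γ s b c_b M) (k : ℕ) :
    ‖s.B k (s.d k)‖ ≤ M * ‖s.d k‖ := (s.B k).le_of_opNorm_le (h.norm_B_le k) _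

theorem continuous_cE (h : SQPAssumptions P D O K ρ H η τ γ s b c_b M) (i : Fin mE) :
    Continuous (P.cE i) := (h.contDiff_cE i).continuous

theorem continuous_cI (h : SQPAssumptions P D O K ρ H η τ γ s b c_b M) (i : Fin mI) :
    Continuous (P.cI i) := (h.contDiff_cI i).continuous

theorem continuous_violation (h : SQPAssumptions P D O K ρ H η τ γ s b c_b M) :
    Continuous P.violation :=
  (continuous_finsetSum _ fun i _ => (h.continuous_cE i).abs).add
    (continuous_finsetSum _ fun i _ => continuous_const.max (h.continuous_cI i).neg)

theorem violation_nonneg (x : Sp n) : 0 ≤ P.violation x :=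
  add_nonneg (Finset.sum_nonneg fun _ _ => abs_nonneg _)
    (Finset.sum_nonneg fun _ _ => le_max_left _ _)

/-- Eventually full steps are taken, and they decrease the merit function. -/
theorem eventually_full_step (h : SQPAssumptions P D O K ρ H η τ γ s b c_b M) :
    ∀ᶠ k in atTop, s.α k = 1 ∧ s.x (k + 1) = s.x k + s.d k ∧
      (1 - c_b) / 2 * inner ℝ (s.d k) (s.B k (s.d k)) ≤
        P.merit (s.x k) (s.θ k) - P.merit (s.x (k + 1)) (s.θ k) := by
  filter_upwards [h.theta_le] with k hk
  have h1 := Problem.merit_decrease h.isOpen h.subset h.upperC2 h.continuousOn_f h.convexOn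
    h.abs_cE h.abs_cI (h.mem k) (h.add_mem k) (h.run.subgradient k) (h.theta_pos k).le
    (h.run.multiplier k) (h.run.solution k).1 (h.le_inner_B k) h.rho_le h.cb_pos.le hk
  have h2 : s.α k = 1 := by
    obtain ⟨j, hj, -, hlt⟩ := h.run.lineSearch k
    rcases Nat.eq_zero_or_pos j with rfl | hj0
    · simpa using hj
    · refine absurd ?_ (hlt 0 hj0)
      rw [Problem.LineSearchCond, pow_zero, one_smul]
      refine le_trans ?_ h1
      nlinarith [h.inner_B_nonneg k, h.eta_le]
  have h3 : s.x (k + 1) = s.x k + s.d k := by rw [h.run.step k, h2, one_smul]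
  exact ⟨h2, h3, h3 ▸ h1⟩

theorem exists_le_f (h : SQPAssumptions P D O K ρ H η τ γ s b c_b M) :
    ∃ m : ℝ, ∀ x ∈ D, m ≤ P.f x ∧ P.f x ≤ -m := by
  obtain ⟨m, hm⟩ := h.isCompact.exists_bound_of_continuousOn (h.continuousOn_f.mono h.subset)
  refine ⟨-m, fun x hx => ?_⟩
  rw [neg_neg]
  exact abs_le.1 (hm x hx)

/-- If the penalty parameters diverge, the constraint violation converges. -/
theorem exists_tendsto_violation (h : SQPAssumptions P D O K ρ H η τ γ s b c_b M)
    (hθ : Tendsto s.θ atTop atTop) :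
    ∃ v, Tendsto (fun k => P.violation (s.x k)) atTop (𝓝 v) := by
  obtain ⟨m, hm⟩ := h.exists_le_f
  obtain ⟨N, hN⟩ := eventually_atTop.1 h.eventually_full_step
  -- The merit function divided by θ, with f shifted to be nonnegative: raising θ can then only
  -- lower the first term, so the decrease survives penalty updates.
  set a : ℕ → ℝ := fun k => (P.f (s.x k) - m) / s.θ k + P.violation (s.x k) with ha
  have hanti : Antitone fun k => a (k + N) := antitone_nat_of_succ_le fun k => by
    obtain ⟨-, -, h3⟩ := hN (k + N) (by omega)
    have h4 : 0 ≤ (1 - c_b) / 2 * inner ℝ (s.d (k + N)) (s.B (k + N) (s.d (k + N))) :=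
      mul_nonneg (by linarith [h.cb_lt]) (h.inner_B_nonneg _)
    have h5 := h.theta_pos (k + N)
    have h6 : (P.f (s.x (k + N + 1)) - m) / s.θ (k + N + 1) ≤
        (P.f (s.x (k + N + 1)) - m) / s.θ (k + N) :=
      div_le_div_of_nonneg_left (by linarith [(hm _ (h.mem (k + N + 1))).1]) h5
        (h.monotone_theta (Nat.le_succ _))
    have h7 : (P.f (s.x (k + N + 1)) - m) / s.θ (k + N) + P.violation (s.x (k + N + 1)) ≤
        (P.f (s.x (k + N)) - m) / s.θ (k + N) + P.violation (s.x (k + N)) := by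
      rw [Problem.merit, Problem.merit] at h3
      rw [div_add' _ _ _ h5.ne', div_add' _ _ _ h5.ne', div_le_div_iff_of_pos_right h5]
      linarith
    have e : k + 1 + N = k + N + 1 := by omega
    simp only [ha, e]
    linarith
  have hbdd : BddBelow (range fun k => a (k + N)) := ⟨0, by
    rintro _ ⟨k, rfl⟩
    exact add_nonneg (div_nonneg (by linarith [(hm _ (h.mem (k + N))).1]) (h.theta_pos _).le)
      (violation_nonneg _)⟩
  obtain ⟨L, hlim⟩ : ∃ L, Tendsto a atTop (𝓝 L) :=
    ⟨_, (tendsto_add_atTop_iff_nat N).1 (tendsto_atTop_ciInf hanti hbdd)⟩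
  have hz : Tendsto (fun k => (P.f (s.x k) - m) / s.θ k) atTop (𝓝 0) := by
    refine squeeze_zero (fun k => div_nonneg (by linarith [(hm _ (h.mem k)).1]) (h.theta_pos k).le)
      (fun k => ?_) (hθ.const_div_atTop (-m - m))
    exact div_le_div_of_nonneg_right (by linarith [(hm _ (h.mem k)).2]) (h.theta_pos k).le
  exact ⟨L, by simpa [ha] using hlim.sub hz⟩

theorem mapClusterPt_of_subseq {φ : ℕ → ℕ}
    (hφ : StrictMono φ) {x : Sp n} (hx : Tendsto (s.x ∘ φ) atTop (𝓝 x)) :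
    MapClusterPt x atTop s.x :=
  hx.mapClusterPt.of_comp hφ.tendsto_atTop

theorem tendsto_sum_smul_gradient {m : ℕ} {c : Fin m → Sp n → ℝ} (hc : ∀ i, ContDiff ℝ 2 (c i))
    {X : ℕ → Sp n} {x : Sp n} (hX : Tendsto X atTop (𝓝 x)) {L : ℕ → Fin m → ℝ} {l : Fin m → ℝ}
    (hL : Tendsto L atTop (𝓝 l)) :
    Tendsto (fun k => ∑ i, L k i • gradient (c i) (X k)) atTop
      (𝓝 (∑ i, l i • gradient (c i) x)) :=
  tendsto_finsetSum _ fun i _ => (tendsto_pi_nhds.1 hL i).smul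
    (((continuous_gradient_of_contDiff (hc i)).tendsto x).comp hX)

theorem tendsto_sum_mul {m : ℕ} {c : Fin m → Sp n → ℝ} (hc : ∀ i, ContDiff ℝ 2 (c i))
    {X : ℕ → Sp n} {x : Sp n} (hX : Tendsto X atTop (𝓝 x)) {L : ℕ → Fin m → ℝ} {l : Fin m → ℝ}
    (hL : Tendsto L atTop (𝓝 l)) :
    Tendsto (fun k => ∑ i, L k i * c i (X k)) atTop (𝓝 (∑ i, l i * c i x)) :=
  tendsto_finsetSum _ fun i _ => (tendsto_pi_nhds.1 hL i).mul
    (((hc i).continuous.tendsto x).comp hX)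

/-- With a vanishing linearization error the penalty parameters cannot diverge. -/
theorem not_tendsto_theta (h : SQPAssumptions P D O K ρ H η τ γ s b c_b M)
    (hH : ((mE + mI : ℕ) : ℝ) * H = 0) : ¬ Tendsto s.θ atTop atTop := by
  intro hθ
  obtain ⟨v, hv⟩ := h.exists_tendsto_violation hθ
  obtain ⟨R, hR⟩ := h.exists_norm_d_le
  have hM : 0 ≤ M := (norm_nonneg _).trans (h.norm_B_le 0)
  -- The penalty must be raised infinitely often; at those indices ‖λ‖∞ > θ − γ, so λ/θ has norm
  -- tending to 1.
  have hfreq : ∃ᶠ k in atTop, s.θ k < max ‖s.lE k‖ ‖s.lI k‖ + γ := by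
    intro hev
    obtain ⟨N, hN⟩ := eventually_atTop.1 hev
    have hconst : ∀ k ≥ N, s.θ k ≤ s.θ N := fun k hk => by
      induction k, hk using Nat.le_induction with
      | base => exact le_rfl
      | succ k hk ih =>
        rw [h.run.penalty k]
        exact max_le ih ((not_lt.1 (hN k hk)).trans ih)
    obtain ⟨k, hk, hk'⟩ := ((hθ.eventually_gt_atTop (s.θ N)).and (eventually_ge_atTop N)).exists
    exact absurd (hconst k hk') (not_le.2 hk)
  obtain ⟨φ, hφ, hφ'⟩ := extraction_of_frequently_atTop hfreq
  set q : ℕ → Sp n × (Fin mE → ℝ) × (Fin mI → ℝ) := fun k =>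
    (s.x k, (s.θ k)⁻¹ • s.lE k, (s.θ k)⁻¹ • s.lI k) with hq
  have hmE : ∀ k, ‖(s.θ k)⁻¹ • s.lE k‖ ≤ 1 := fun k => by
    rw [norm_smul, norm_inv, Real.norm_of_nonneg (h.theta_pos k).le, inv_mul_le_one₀ (h.theta_pos k)]
    exact (pi_norm_le_iff_of_nonneg (h.theta_pos k).le).2 (h.run.multiplier k).abs_lE_le
  have hmI : ∀ k, ‖(s.θ k)⁻¹ • s.lI k‖ ≤ 1 := fun k => by
    rw [norm_smul, norm_inv, Real.norm_of_nonneg (h.theta_pos k).le, inv_mul_le_one₀ (h.theta_pos k)]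
    refine (pi_norm_le_iff_of_nonneg (h.theta_pos k).le).2 fun i => ?_
    rw [Real.norm_of_nonneg ((h.run.multiplier k).lI_nonneg i)]
    exact (h.run.multiplier k).lI_le i
  have hqc : ∀ k, (q ∘ φ) k ∈ D ×ˢ Metric.closedBall (0 : Fin mE → ℝ) 1 ×ˢ
      Metric.closedBall (0 : Fin mI → ℝ) 1 := fun k =>
    ⟨h.mem _, by simpa [hq] using hmE (φ k), by simpa [hq] using hmI (φ k)⟩
  obtain ⟨⟨x, aE, aI⟩, ⟨-, haE, haI⟩, ψ, hψ, hlim⟩ := (h.isCompact.prod ((isCompact_closedBall _ _).prod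
    (isCompact_closedBall _ _))).tendsto_subseq hqc
  set χ := φ ∘ ψ with hχ
  have hχm : StrictMono χ := hφ.comp hψ
  have hχt := hχm.tendsto_atTop
  have lx : Tendsto (s.x ∘ χ) atTop (𝓝 x) := (continuous_fst.tendsto _).comp hlim
  have lE : Tendsto (fun k => (s.θ (χ k))⁻¹ • s.lE (χ k)) atTop (𝓝 aE) :=
    ((continuous_fst.comp continuous_snd).tendsto _).comp hlim
  have lI : Tendsto (fun k => (s.θ (χ k))⁻¹ • s.lI (χ k)) atTop (𝓝 aI) :=
    ((continuous_snd.comp continuous_snd).tendsto _).comp hlim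
  have lθ : Tendsto (fun k => (s.θ (χ k))⁻¹) atTop (𝓝 0) :=
    tendsto_inv_atTop_zero.comp (hθ.comp hχt)
  have haI0 : ∀ i, 0 ≤ aI i ∧ aI i ≤ 1 := fun i =>
    ⟨ge_of_tendsto' (tendsto_pi_nhds.1 lI i) fun k =>
      mul_nonneg (inv_nonneg.2 (h.theta_pos _).le) ((h.run.multiplier _).lI_nonneg i),
     (le_abs_self _).trans ((norm_le_pi_norm aI i).trans (by simpa using haI))⟩
  have haE0 : ∀ i, |aE i| ≤ 1 := fun i => (norm_le_pi_norm aE i).trans (by simpa using haE)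
  have hgB : ∀ k, ‖s.g k + s.B k (s.d k)‖ ≤ K + M * R := fun k =>
    (norm_add_le _ _).trans (add_le_add (h.norm_g_le k) ((h.norm_B_apply_le k).trans
      (mul_le_mul_of_nonneg_left (hR k) hM)))
  have hgrad : ∑ i, aE i • gradient (P.cE i) x + ∑ i, aI i • gradient (P.cI i) x = 0 := by
    refine tendsto_nhds_unique ((tendsto_sum_smul_gradient h.contDiff_cE lx lE).add
      (tendsto_sum_smul_gradient h.contDiff_cI lx lI)) ?_
    refine squeeze_zero_norm (a := fun k => (s.θ (χ k))⁻¹ * (K + M * R)) (fun k => ?_)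
      (by simpa using lθ.mul_const (K + M * R))
    have e := sub_eq_zero.1 (h.run.multiplier (χ k)).1
    have : ∑ i, ((s.θ (χ k))⁻¹ • s.lE (χ k)) i • gradient (P.cE i) ((s.x ∘ χ) k) +
        ∑ i, ((s.θ (χ k))⁻¹ • s.lI (χ k)) i • gradient (P.cI i) ((s.x ∘ χ) k) =
        (s.θ (χ k))⁻¹ • (s.g (χ k) + s.B (χ k) (s.d (χ k))) := by
      rw [e, smul_add, Finset.smul_sum, Finset.smul_sum]
      simp [smul_smul]
    rw [this, norm_smul, norm_inv, Real.norm_of_nonneg (h.theta_pos _).le]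
    exact mul_le_mul_of_nonneg_left (hgB _) (inv_nonneg.2 (h.theta_pos _).le)
  -- Without linearization error the slack sum is at least the violation at the next iterate.
  -- Convergence of the violation along the whole sequence identifies its limit there with the
  -- violation at x.
  have hval : ∑ i, aE i * P.cE i x + ∑ i, aI i * P.cI i x ≤ -P.violation x := by
    have l1 := (tendsto_sum_mul h.contDiff_cE lx lE).add (tendsto_sum_mul h.contDiff_cI lx lI)
    have hvx : v = P.violation x :=
      tendsto_nhds_unique (hv.comp hχt) ((h.continuous_violation.tendsto x).comp lx)
    have l2 : Tendsto (fun k => -P.violation (s.x (χ k + 1)) +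
        (s.θ (χ k))⁻¹ * ((K + M * R) * R)) atTop (𝓝 (-P.violation x + 0 * ((K + M * R) * R))) := by
      refine ((hvx ▸ hv).comp ((tendsto_add_atTop_nat 1).comp hχt)).neg.add (lθ.mul_const _)
    rw [zero_mul, add_zero] at l2
    refine le_of_tendsto_of_tendsto l1 l2 ?_
    filter_upwards [hχt.eventually h.eventually_full_step] with k hk
    have e1 := (h.run.multiplier (χ k)).inner_add_eq (h.run.solution (χ k)).1
    have e2 := Problem.violation_add_le h.abs_cE h.abs_cI (h.mem (χ k)) (h.add_mem (χ k))
      (h.run.solution (χ k)).1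
    rw [hH, zero_div, zero_mul, add_zero, ← hk.2.1] at e2
    have e3 : -((K + M * R) * R) ≤ inner ℝ (s.g (χ k)) (s.d (χ k)) +
        inner ℝ (s.d (χ k)) (s.B (χ k) (s.d (χ k))) := by
      rw [real_inner_comm (s.B (χ k) (s.d (χ k))), ← inner_add_left]
      refine (abs_le.1 ((abs_real_inner_le_norm _ _).trans ?_)).1
      exact mul_le_mul (hgB _) (hR _) (norm_nonneg _) ((norm_nonneg _).trans (hgB 0))
    have hp := h.theta_pos (χ k)
    have e4 : ∑ i, ((s.θ (χ k))⁻¹ • s.lE (χ k)) i * P.cE i ((s.x ∘ χ) k) +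
        ∑ i, ((s.θ (χ k))⁻¹ • s.lI (χ k)) i * P.cI i ((s.x ∘ χ) k) =
        (s.θ (χ k))⁻¹ * (∑ i, s.lE (χ k) i * P.cE i (s.x (χ k)) +
          ∑ i, s.lI (χ k) i * P.cI i (s.x (χ k))) := by
      rw [mul_add, Finset.mul_sum, Finset.mul_sum]
      simp [mul_assoc]
    have e5 := mul_le_mul_of_nonneg_left e2 hp.le
    rw [e4, ← sub_le_iff_le_add, ← mul_sub, inv_mul_le_iff₀ hp]
    linarith
  -- Each term of the sum is at least minus the violation of its own constraint, so `hval` forces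
  -- equality term by term. Since x may be infeasible, MFCQ is needed for violated inequalities too.
  have hzero : ∀ i, 0 < P.cI i x → aI i = 0 := by
    have hE' : ∀ i, 0 ≤ aE i * P.cE i x + |P.cE i x| := fun i => by
      linarith [Problem.neg_le_mul_of_abs_le (c := P.cE i x) (haE0 i)]
    have hI' : ∀ i, 0 ≤ aI i * P.cI i x + max 0 (-P.cI i x) := fun i => by
      linarith [Problem.neg_mul_max_le (c := P.cI i x) (haI0 i).1 (haI0 i).2]
    have hsum : ∑ i, (aI i * P.cI i x + max 0 (-P.cI i x)) ≤ 0 := by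
      have := Finset.sum_nonneg fun i (_ : i ∈ Finset.univ) => hE' i
      rw [Finset.sum_add_distrib] at this ⊢
      rw [Problem.violation] at hval
      linarith
    have heq := (Finset.sum_eq_zero_iff_of_nonneg fun i _ => hI' i).1
      (le_antisymm hsum (Finset.sum_nonneg fun i _ => hI' i))
    intro i hi
    have := heq i (Finset.mem_univ i)
    rw [max_eq_left (by linarith), add_zero] at this
    exact (mul_eq_zero.1 this).resolve_right hi.ne'
  obtain ⟨z1, z2⟩ := (h.mfcq x (mapClusterPt_of_subseq hχm lx)).multiplier_eq_zero hgrad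
    (fun i => (haI0 i).1) hzero
  have l3 := lE.norm.max lI.norm
  rw [z1, z2, norm_zero, norm_zero, max_self] at l3
  have l4 : Tendsto (fun k => 1 - (s.θ (χ k))⁻¹ * γ) atTop (𝓝 (1 - 0 * γ)) :=
    tendsto_const_nhds.sub (lθ.mul_const γ)
  have : (1 : ℝ) - 0 * γ ≤ 0 := by
    refine le_of_tendsto_of_tendsto' l4 l3 fun k => ?_
    have hp := h.theta_pos (χ k)
    rw [norm_smul, norm_smul, norm_inv, Real.norm_of_nonneg hp.le,
      ← mul_max_of_nonneg _ _ (inv_nonneg.2 hp.le), sub_le_iff_le_add, ← mul_add,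
      ← inv_mul_cancel₀ hp.ne']
    exact mul_le_mul_of_nonneg_left (hφ' (ψ k)).le (inv_nonneg.2 hp.le)
  linarith

/-- The bound θ_k c_h ≤ c_b b limits θ_k only when c_h > 0; it says nothing when c_h = 0, where MFCQ
has to act. -/
theorem exists_theta_le (h : SQPAssumptions P D O K ρ H η τ γ s b c_b M) :
    ∃ Θ : ℝ, ∀ k, s.θ k ≤ Θ := by
  by_contra! hcon
  have hθ : Tendsto s.θ atTop atTop := tendsto_atTop_atTop_of_monotone h.monotone_theta
    fun a => (hcon a).imp fun _ hk => hk.le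
  have hpos : 0 < ((mE + mI : ℕ) : ℝ) * H := by
    rcases (mul_nonneg (Nat.cast_nonneg (mE + mI)) h.H_nonneg).eq_or_lt with h0 | h0
    · exact absurd hθ (h.not_tendsto_theta h0.symm)
    · exact h0
  obtain ⟨k, h1, h2⟩ := (h.theta_le.and (hθ.eventually_gt_atTop (c_b * b / (((mE + mI : ℕ) : ℝ) * H)))).exists
  rw [div_lt_iff₀ hpos] at h2
  linarith

end SQPAssumptions

/-! ### Finite length from the Kurdyka-Łojasiewicz inequality -/

/-- The KL inequality in integrated form: concavity bounds the increment of φ below by φ′(ℓ − L)(ℓ −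
ℓ′), and φ′(ℓ − L)‖u‖ ≥ 1 for every limiting subgradient u. -/
theorem KLPropertyAt.exists_desingularization {V : Type*} [NormedAddCommGroup V]
    [InnerProductSpace ℝ V] {h : V → EReal} {x₀ : V} (hKL : KLPropertyAt h x₀) {L : ℝ}
    (hL : h x₀ = L) :
    ∃ r > 0, ∃ U ∈ 𝓝 x₀, ∃ ψ : ℝ → ℝ, MonotoneOn ψ (Ico 0 r) ∧ (∀ s ∈ Ico 0 r, 0 ≤ ψ s) ∧
      ∀ x ∈ U, ∀ u ∈ limSubdiff h x, ∀ ℓ ℓ' : ℝ, h x = ℓ → L < ℓ → ℓ < L + r → L ≤ ℓ' → ℓ' ≤ ℓ →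
        ℓ - ℓ' ≤ (ψ (ℓ - L) - ψ (ℓ' - L)) * ‖u‖ := by
  obtain ⟨r, hr, U, hU, φ, hc, hconc, hnn, -, hd, hpos, hineq⟩ := hKL
  refine ⟨r, hr, U, hU, φ, ?_, hnn, fun x hx u hu ℓ ℓ' hℓ h1 h2 h3 h4 => ?_⟩
  · exact (strictMonoOn_of_deriv_pos (convex_Ico 0 r) hc (by simpa using hpos)).monotoneOn
  have hs : ℓ - L ∈ Ioo 0 r := ⟨by linarith, by linarith⟩
  have hk := hineq x hx (by rw [hL, hℓ]; exact_mod_cast h1)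
    (by rw [hL, hℓ]; exact_mod_cast h2)
  rw [hL, hℓ, EReal.toReal_coe, EReal.toReal_coe] at hk
  have hu' : Metric.infEDist (0 : V) (limSubdiff h x) ≤ ENNReal.ofReal ‖u‖ := by
    refine (Metric.infEDist_le_edist_of_mem hu).trans ?_
    rw [edist_comm, edist_dist, dist_zero_right]
  have hk' := hk.trans (mul_le_mul_right hu' _)
  rw [← ENNReal.ofReal_mul (hpos _ hs).le, ← ENNReal.ofReal_one,
    ENNReal.ofReal_le_ofReal_iff (mul_nonneg (hpos _ hs).le (norm_nonneg _))] at hk'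
  have hdiff : DifferentiableAt ℝ φ (ℓ - L) :=
    (hd.differentiableOn (by norm_num)).differentiableAt (isOpen_Ioo.mem_nhds hs)
  rcases h4.eq_or_lt with rfl | h4
  · simp
  have hsl := hconc.deriv_le_slope (x := ℓ' - L) (y := ℓ - L) ⟨by linarith, by linarith⟩
    ⟨hs.1.le, hs.2⟩ (by linarith) hdiff
  rw [slope_def_field, le_div_iff₀ (by linarith)] at hsl
  have h5 : ℓ - L - (ℓ' - L) = ℓ - ℓ' := by ring
  rw [h5] at hsl
  have h6 := mul_le_mul_of_nonneg_right hsl (norm_nonneg u)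
  nlinarith

/-- Finite length of descent sequences with the Kurdyka-Łojasiewicz property at their cluster
points. -/
theorem summable_of_KLPropertyAt {V : Type*} [NormedAddCommGroup V]
    [InnerProductSpace ℝ V] [FiniteDimensional ℝ V] {h : V → EReal} {z : ℕ → V}
    (hz : Bornology.IsBounded (range z)) {ℓ : ℕ → ℝ} (hℓ : ∀ k, h (z k) = ℓ k) {δ : ℕ → ℝ}
    (hδ : ∀ k, 0 ≤ δ k) {a : ℝ} (ha : 0 < a) (hdec : ∀ k, a * δ k ^ 2 ≤ ℓ k - ℓ (k + 1)) {C : ℝ}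
    (hC : 0 ≤ C) (hsub : ∀ k, ∃ u ∈ limSubdiff h (z k), ‖u‖ ≤ C * δ k) {L : ℝ}
    (hL : Tendsto ℓ atTop (𝓝 L))
    (hcl : ∀ x, MapClusterPt x atTop z → h x = L ∧ KLPropertyAt h x) : Summable δ := by
  have := FiniteDimensional.proper_real V
  have hanti : Antitone ℓ := antitone_nat_of_succ_le fun k => by
    nlinarith [hdec k, mul_nonneg ha.le (sq_nonneg (δ k))]
  have hLle : ∀ k, L ≤ ℓ k := fun k => hanti.le_of_tendsto hL k
  obtain ⟨R, hR⟩ := hz.subset_closedBall 0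
  set ω := {x | MapClusterPt x atTop z} with hω
  have hωc : IsCompact ω := by
    refine (isCompact_closedBall (0 : V) R).of_isClosed_subset isClosed_setOfPred_clusterPt ?_
    intro x hx
    exact Metric.isClosed_closedBall.mem_of_mapClusterPt hx
      (Eventually.of_forall fun k => hR ⟨k, rfl⟩)
  choose r hr U hU ψ hmono hnn hψ using fun (x : V) (hx : x ∈ ω) =>
    (hcl x hx).2.exists_desingularization (hcl x hx).1
  obtain ⟨t, ht⟩ := hωc.elim_nhds_subcover' (fun x hx => interior (U x hx))
    fun x hx => interior_mem_nhds.2 (hU x hx)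
  set W := ⋃ x ∈ t, interior (U x.1 x.2) with hW
  have hWo : IsOpen W := isOpen_biUnion fun x _ => isOpen_interior
  have hev : ∀ᶠ k in atTop, z k ∈ W := by
    by_contra hcon
    have hfr : ∃ᶠ k in atTop, z k ∈ Metric.closedBall (0 : V) R \ W :=
      (not_eventually.1 hcon).mono fun k hk => ⟨hR ⟨k, rfl⟩, hk⟩
    obtain ⟨x, hx, hxc⟩ := ((isCompact_closedBall (0 : V) R).diff hWo
      ).exists_mapClusterPt_of_frequently hfr
    exact hx.2 (ht hxc)
  have hev2 : ∀ᶠ k in atTop, ∀ x ∈ t, ℓ k < L + r x.1 x.2 :=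
    (Finset.eventually_all t).2 fun x _ => hL.eventually_lt_const (by linarith [hr x.1 x.2])
  obtain ⟨N, hN⟩ := eventually_atTop.1 (hev.and hev2)
  -- Finitely many KL neighbourhoods cover the compact cluster set. Each ψ is monotone, so the
  -- decrease of the sum dominates that of every summand, and one function Ψ serves for all of them.
  set Ψ : ℕ → ℝ := fun k => ∑ x ∈ t, ψ x.1 x.2 (ℓ k - L) with hΨ
  have hmem : ∀ k ≥ N, ∀ x ∈ t, ℓ k - L ∈ Ico 0 (r x.1 x.2) := fun k hk x hx =>
    ⟨by linarith [hLle k], by linarith [(hN k hk).2 x hx]⟩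
  have hstep : ∀ k ≥ N, ∀ x ∈ t, ψ x.1 x.2 (ℓ (k + 1) - L) ≤ ψ x.1 x.2 (ℓ k - L) :=
    fun k hk x hx => hmono x.1 x.2 (hmem (k + 1) (by omega) x hx) (hmem k hk x hx)
      (by linarith [hanti (Nat.le_succ k)])
  have hΨle : ∀ k ≥ N, ∀ x ∈ t, ψ x.1 x.2 (ℓ k - L) - ψ x.1 x.2 (ℓ (k + 1) - L) ≤
      Ψ k - Ψ (k + 1) := fun k hk x hx => by
    rw [hΨ, ← Finset.sum_sub_distrib]
    exact Finset.single_le_sum (f := fun x => ψ x.1 x.2 (ℓ k - L) - ψ x.1 x.2 (ℓ (k + 1) - L))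
      (fun y hy => by linarith [hstep k hk y hy]) hx
  have hΨanti : ∀ k ≥ N, 0 ≤ Ψ k - Ψ (k + 1) := fun k hk => by
    rw [hΨ, ← Finset.sum_sub_distrib]
    exact Finset.sum_nonneg fun y hy => by linarith [hstep k hk y hy]
  have hΨnn : ∀ k ≥ N, 0 ≤ Ψ k := fun k hk =>
    Finset.sum_nonneg fun x hx => hnn x.1 x.2 _ (hmem k hk x hx)
  have hbound : ∀ k ≥ N, δ k ≤ C / a * (Ψ k - Ψ (k + 1)) := fun k hk => by
    have hrhs : 0 ≤ C / a * (Ψ k - Ψ (k + 1)) := mul_nonneg (by positivity) (hΨanti k hk)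
    rcases (hδ k).eq_or_lt with h0 | h0
    · rwa [← h0]
    have hlt : ℓ (k + 1) < ℓ k := by nlinarith [hdec k, mul_pos ha (pow_pos h0 2)]
    obtain ⟨x, hx, hxU⟩ := mem_iUnion₂.1 (hN k hk).1
    obtain ⟨u, hu, huC⟩ := hsub k
    have h1 := hψ x.1 x.2 (z k) (interior_subset hxU) u hu (ℓ k) (ℓ (k + 1)) (hℓ k)
      ((hLle _).trans_lt hlt) ((hN k hk).2 x hx) (hLle _) hlt.le
    have h2 : (ψ x.1 x.2 (ℓ k - L) - ψ x.1 x.2 (ℓ (k + 1) - L)) * ‖u‖ ≤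
        (Ψ k - Ψ (k + 1)) * (C * δ k) :=
      mul_le_mul (hΨle k hk x hx) huC (norm_nonneg _) (hΨanti k hk)
    -- The decrease and the subgradient bound involve the same δ k, so one factor cancels and the
    -- estimate telescopes directly.
    have h3 : a * δ k * δ k ≤ (Ψ k - Ψ (k + 1)) * C * δ k := by nlinarith [hdec k]
    have h4 := le_of_mul_le_mul_right h3 h0
    rw [div_mul_eq_mul_div, le_div_iff₀ ha]
    linarith
  refine (summable_nat_add_iff N).1 (summable_of_sum_range_le (c := C / a * Ψ N)
    (fun k => hδ _) fun m => ?_)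
  calc ∑ k ∈ Finset.range m, δ (k + N)
      ≤ ∑ k ∈ Finset.range m, C / a * (Ψ (k + N) - Ψ (k + 1 + N)) :=
        Finset.sum_le_sum fun k _ => by
          have := hbound (k + N) (by omega)
          rwa [show k + N + 1 = k + 1 + N by omega] at this
    _ = C / a * (Ψ N - Ψ (m + N)) := by
        rw [← Finset.mul_sum, Finset.sum_range_sub' (fun k => Ψ (k + N))]
        simp
    _ ≤ C / a * Ψ N := mul_le_mul_of_nonneg_left (by linarith [hΨnn (m + N) (by omega)])
        (by positivity)

/-! ### Values and subgradients of the potential function -/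

namespace Problem

variable {n mE mI : ℕ} {P : Problem n mE mI}

theorem le_conjugateFun_dcFun {D : Set (Sp n)} {σ : ℝ} {x : Sp n} (hx : x ∈ D) (y : Sp n) :
    ((inner ℝ y x + P.f x - σ / 2 * ‖x‖ ^ 2 : ℝ) : EReal) ≤ conjugateFun (P.dcFun D σ) y := by
  refine le_trans ?_ (le_iSup _ x)
  rw [dcFun, if_pos hx, ← EReal.coe_sub, EReal.coe_le_coe_iff]
  linarith

/-- The upper model of f at x says that σx − g is a subgradient of F at x, which is the case of
equality in Fenchel–Young. -/
theorem conjugateFun_dcFun_eq {D : Set (Sp n)} {σ : ℝ} {x g : Sp n} (hx : x ∈ D)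
    (hg : ∀ y ∈ D, P.f y ≤ P.f x + inner ℝ g (y - x) + σ / 2 * ‖y - x‖ ^ 2) :
    conjugateFun (P.dcFun D σ) (σ • x - g) =
      ((inner ℝ (σ • x - g) x + P.f x - σ / 2 * ‖x‖ ^ 2 : ℝ) : EReal) := by
  refine le_antisymm (iSup_le fun y => ?_) (le_conjugateFun_dcFun hx _)
  by_cases hy : y ∈ D
  · rw [dcFun, if_pos hy, ← EReal.coe_sub, EReal.coe_le_coe_iff]
    have h1 := hg y hy
    rw [norm_sub_sq_real, inner_sub_right] at h1
    rw [inner_sub_left, inner_sub_left, inner_smul_left, inner_smul_left, RCLike.conj_to_real,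
      real_inner_self_eq_norm_sq, real_inner_comm y x]
    linarith
  · rw [dcFun, if_neg hy]
    simp

/-- The value of the potential function at a pair consisting of an iterate and a subgradient. -/
theorem potential_eq {D : Set (Sp n)} {σ l : ℝ} {x x' g : Sp n} (hx : x ∈ D)
    (hg : ∀ y ∈ D, P.f y ≤ P.f x + inner ℝ g (y - x) + σ / 2 * ‖y - x‖ ^ 2)
    (hC : (x', x) ∈ P.linFeasible) :
    P.potential D σ l (WithLp.toLp 2 ![x', σ • x - g, x]) =
      ((P.f x + inner ℝ g (x' - x) + (σ + l) / 2 * ‖x' - x‖ ^ 2 : ℝ) : EReal) := by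
  simp only [potential, Fin.isValue, Matrix.cons_val_zero, Matrix.cons_val_one, Matrix.cons_val]
  rw [conjugateFun_dcFun_eq hx hg, indicatorFun, if_pos hC, add_zero, ← EReal.coe_add,
    EReal.coe_eq_coe_iff]
  rw [norm_sub_sq_real, inner_sub_left, inner_sub_left, inner_sub_right, inner_smul_left,
    inner_smul_left, RCLike.conj_to_real, real_inner_self_eq_norm_sq, real_inner_comm x x']
  ring

/-- Differentiating c(w) + ⟨∇c(w), x − w⟩ in w, the two first-order terms cancel. The surviving
Hessian term carries the factor x − w, which keeps the subgradient of the potential of order ‖x −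
w‖. -/
theorem hasFDerivAt_linearized {c : Sp n → ℝ} (hc : ContDiff ℝ 2 c)
    (z : PiLp 2 (fun _ : Fin 3 => Sp n)) :
    ∃ T : PiLp 2 (fun _ : Fin 3 => Sp n) →L[ℝ] ℝ,
      HasFDerivAt (fun z : PiLp 2 (fun _ : Fin 3 => Sp n) => linearized c (z 0) (z 2)) T z ∧
      ∀ v, T v = inner ℝ (gradient c (z 2)) (v 0)
        + inner ℝ (fderiv ℝ (gradient c) (z 2) (v 2)) (z 0 - z 2) := by
  have p0 : HasFDerivAt (fun z : PiLp 2 (fun _ : Fin 3 => Sp n) => z 0)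
    (PiLp.proj 2 (fun _ : Fin 3 => Sp n) 0) z :=
    (PiLp.proj (𝕜 := ℝ) 2 (fun _ : Fin 3 => Sp n) 0).hasFDerivAt
  have p2 : HasFDerivAt (fun z : PiLp 2 (fun _ : Fin 3 => Sp n) => z 2)
    (PiLp.proj 2 (fun _ : Fin 3 => Sp n) 2) z :=
    (PiLp.proj (𝕜 := ℝ) 2 (fun _ : Fin 3 => Sp n) 2).hasFDerivAt
  have h1 : HasFDerivAt c _ (z 2) :=
    ((hc.differentiable (by norm_num)) (z 2)).hasGradientAt.hasFDerivAt
  have hgd : DifferentiableAt ℝ (gradient c) (z 2) :=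
    ((InnerProductSpace.toDual ℝ (Sp n)).symm.differentiable).differentiableAt.comp _
      (((hc.fderiv_right (m := 1) (by norm_num)).differentiable (by norm_num)) (z 2))
  have q1 : HasFDerivAt (fun z : PiLp 2 (fun _ : Fin 3 => Sp n) => gradient c (z 2)) _ z :=
    HasFDerivAt.comp (g := gradient c) (f := fun z : PiLp 2 (fun _ : Fin 3 => Sp n) => z 2) z
      hgd.hasFDerivAt p2
  have q2 : HasFDerivAt (fun z : PiLp 2 (fun _ : Fin 3 => Sp n) => c (z 2)) _ z :=
    HasFDerivAt.comp z h1 p2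
  have q3 : HasFDerivAt (fun z : PiLp 2 (fun _ : Fin 3 => Sp n) => z 0 - z 2) _ z := p0.sub p2
  refine ⟨_, q2.add (q1.inner ℝ q3), fun v => ?_⟩
  simp [fderivInnerCLM_apply, inner_sub_right]
  ring

theorem mem_limSubdiff_of_mem_regSubdiff {V : Type*} [NormedAddCommGroup V]
    [InnerProductSpace ℝ V] {h : V → EReal} {x u : V} (hu : u ∈ regSubdiff h x) :
    u ∈ limSubdiff h x :=
  ⟨hu.1, hu.2.1, fun _ => x, fun _ => u, tendsto_const_nhds, tendsto_const_nhds, fun _ => hu,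
    tendsto_const_nhds⟩

/-- The gradient of a smooth minorant is a regular subgradient. -/
theorem _root_.toDual_symm_mem_regSubdiff {V : Type*} [NormedAddCommGroup V]
    [InnerProductSpace ℝ V] [CompleteSpace V] {h : V → EReal} {S : V → ℝ} {x : V} {T : V →L[ℝ] ℝ}
    (hS : HasFDerivAt S T x) (hx : h x = S x) (hle : ∀ y, (S y : EReal) ≤ h y) :
    (InnerProductSpace.toDual ℝ V).symm T ∈ regSubdiff h x := by
  refine ⟨by rw [hx]; exact EReal.coe_ne_top _, by rw [hx]; exact EReal.coe_ne_bot _,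
    fun ε hε => ?_⟩
  filter_upwards [(hasFDerivAt_iff_isLittleO.1 hS).def hε] with y hy
  refine le_trans (EReal.coe_le_coe_iff.2 ?_) (hle y)
  rw [hx, EReal.toReal_coe, InnerProductSpace.toDual_symm_apply]
  have := (abs_le.1 (Real.norm_eq_abs _ ▸ hy)).1
  linarith

/-- Regular subgradients of the potential function from multipliers of the linearized
constraints. -/
theorem exists_mem_limSubdiff_potential {D : Set (Sp n)} {σ l : ℝ} {x x' g e : Sp n} (hx : x ∈ D)
    (hg : ∀ y ∈ D, P.f y ≤ P.f x + inner ℝ g (y - x) + σ / 2 * ‖y - x‖ ^ 2)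
    (hC : (x', x) ∈ P.linFeasible)
    (hcE : ∀ i, ContDiff ℝ 2 (P.cE i)) (hcI : ∀ i, ContDiff ℝ 2 (P.cI i))
    {lE : Fin mE → ℝ} {lI : Fin mI → ℝ} (hlI : ∀ i, 0 ≤ lI i)
    (hcompl : ∀ i, lI i * linearized (P.cI i) x' x = 0)
    (he : g + e = ∑ i, lE i • gradient (P.cE i) x + ∑ i, lI i • gradient (P.cI i) x)
    {A : ℝ} (hA0 : 0 ≤ A) (hAE : ∀ i, |lE i| * ‖fderiv ℝ (gradient (P.cE i)) x‖ ≤ A)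
    (hAI : ∀ i, |lI i| * ‖fderiv ℝ (gradient (P.cI i)) x‖ ≤ A) :
    ∃ u ∈ limSubdiff (P.potential D σ l) (WithLp.toLp 2 ![x', σ • x - g, x]),
      ‖u‖ ≤ (1 + |σ| + 2 * |l| + (mE + mI) * A) * ‖x' - x‖ + ‖e‖ := by
  set z₀ : PiLp 2 (fun _ : Fin 3 => Sp n) := WithLp.toLp 2 ![x', σ • x - g, x] with hz₀
  have z0 : z₀ 0 = x' := rfl
  have z1 : z₀ 1 = σ • x - g := rfl
  have z2 : z₀ 2 = x := rfl
  choose TE hTE hTE' using fun i => hasFDerivAt_linearized (hcE i) z₀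
  choose TI hTI hTI' using fun i => hasFDerivAt_linearized (hcI i) z₀
  have p0 : HasFDerivAt (fun z : PiLp 2 (fun _ : Fin 3 => Sp n) => z 0)
    (PiLp.proj 2 (fun _ : Fin 3 => Sp n) 0) z₀ :=
    (PiLp.proj (𝕜 := ℝ) 2 (fun _ : Fin 3 => Sp n) 0).hasFDerivAt
  have p1 : HasFDerivAt (fun z : PiLp 2 (fun _ : Fin 3 => Sp n) => z 1)
    (PiLp.proj 2 (fun _ : Fin 3 => Sp n) 1) z₀ :=
    (PiLp.proj (𝕜 := ℝ) 2 (fun _ : Fin 3 => Sp n) 1).hasFDerivAt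
  have p2 : HasFDerivAt (fun z : PiLp 2 (fun _ : Fin 3 => Sp n) => z 2)
    (PiLp.proj 2 (fun _ : Fin 3 => Sp n) 2) z₀ :=
    (PiLp.proj (𝕜 := ℝ) 2 (fun _ : Fin 3 => Sp n) 2).hasFDerivAt
  -- A smooth minorant touching the potential at `z₀`: F* is replaced by its affine minorant from
  -- the point x, the indicator by minus the Lagrangian terms. Complementarity makes it exact at
  -- `z₀`.
  set S : PiLp 2 (fun _ : Fin 3 => Sp n) → ℝ := fun z =>
    -(inner ℝ (z 1) (z 0)) + σ / 2 * ‖z 0‖ ^ 2 + l / 2 * ‖z 0 - z 2‖ ^ 2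
      + (inner ℝ (z 1) x + P.f x - σ / 2 * ‖x‖ ^ 2)
      - (∑ i, lE i * linearized (P.cE i) (z 0) (z 2) + ∑ i, lI i * linearized (P.cI i) (z 0) (z 2))
    with hSdef
  obtain ⟨T, hT, hT'⟩ : ∃ T : PiLp 2 (fun _ : Fin 3 => Sp n) →L[ℝ] ℝ, HasFDerivAt S T z₀ ∧
      ∀ v, T v = -(inner ℝ (v 1) x') - inner ℝ (σ • x - g) (v 0) + σ * inner ℝ x' (v 0)
        + l * inner ℝ (x' - x) (v 0 - v 2) + inner ℝ (v 1) x
        - (∑ i, lE i * TE i v + ∑ i, lI i * TI i v) := by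
    refine ⟨_, ((((p1.inner ℝ p0).neg.add ((p0.norm_sq).const_mul (σ / 2))).add
      (((p0.sub p2).norm_sq).const_mul (l / 2))).add
      (((p1.inner ℝ (hasFDerivAt_const x z₀)).add_const _).sub_const _)).sub
      ((HasFDerivAt.fun_sum fun i _ => (hTE i).const_mul (lE i)).add
        (HasFDerivAt.fun_sum fun i _ => (hTI i).const_mul (lI i))), fun v => ?_⟩
    simp [fderivInnerCLM_apply, z0, z1, z2]
    simp only [inner_sub_left, inner_sub_right]
    ring
  have hval : P.potential D σ l z₀ = S z₀ := by
    rw [potential_eq hx hg hC, EReal.coe_eq_coe_iff]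
    have hE0 : ∑ i, lE i * linearized (P.cE i) x' x = 0 :=
      Finset.sum_eq_zero fun i _ => by rw [hC.1 i, mul_zero]
    have hI0 : ∑ i, lI i * linearized (P.cI i) x' x = 0 :=
      Finset.sum_eq_zero fun i _ => hcompl i
    simp only [hSdef, z0, z1, z2, hE0, hI0]
    rw [norm_sub_sq_real, inner_sub_left, inner_sub_left, inner_sub_right, inner_smul_left,
      inner_smul_left, RCLike.conj_to_real, real_inner_self_eq_norm_sq, real_inner_comm x x']
    ring
  have hle : ∀ z, (S z : EReal) ≤ P.potential D σ l z := fun z => by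
    have hconj := le_conjugateFun_dcFun (P := P) (σ := σ) hx (z 1)
    by_cases hz : (z 0, z 2) ∈ P.linFeasible
    · rw [potential, indicatorFun, if_pos hz, add_zero]
      refine le_trans ?_ (add_le_add_right hconj _)
      rw [← EReal.coe_add, EReal.coe_le_coe_iff, hSdef]
      have hE0 : ∑ i, lE i * linearized (P.cE i) (z 0) (z 2) = 0 :=
        Finset.sum_eq_zero fun i _ => by rw [hz.1 i, mul_zero]
      have hI0 : 0 ≤ ∑ i, lI i * linearized (P.cI i) (z 0) (z 2) :=
        Finset.sum_nonneg fun i _ => mul_nonneg (hlI i) (hz.2 i)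
      simp only [hE0]
      linarith
    · rw [potential, indicatorFun, if_neg hz, EReal.add_top_of_ne_bot]
      · exact le_top
      · refine EReal.add_ne_bot_iff.2 ⟨EReal.coe_ne_bot _, ?_⟩
        exact ne_bot_of_le_ne_bot (EReal.coe_ne_bot _) hconj
  refine ⟨_, mem_limSubdiff_of_mem_regSubdiff (toDual_symm_mem_regSubdiff hT hval hle), ?_⟩
  rw [LinearIsometryEquiv.norm_map]
  refine T.opNorm_le_bound (by positivity) fun v => ?_
  have hcomp : ∀ i, ‖v i‖ ≤ ‖v‖ := fun i => PiLp.norm_apply_le v i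
  have hterm : ∀ {G : Sp n →L[ℝ] Sp n} {a : ℝ}, |a| * ‖G‖ ≤ A →
      |a * inner ℝ (G (v 2)) (x' - x)| ≤ A * ‖x' - x‖ * ‖v‖ := fun {G a} hGa => by
    rw [abs_mul]
    calc |a| * |inner ℝ (G (v 2)) (x' - x)| ≤ |a| * ((‖G‖ * ‖v‖) * ‖x' - x‖) := by
          gcongr
          refine (abs_real_inner_le_norm _ _).trans ?_
          gcongr
          exact (G.le_opNorm _).trans (mul_le_mul_of_nonneg_left (hcomp 2) (norm_nonneg _))
      _ = |a| * ‖G‖ * ‖x' - x‖ * ‖v‖ := by ring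
      _ ≤ A * ‖x' - x‖ * ‖v‖ := by gcongr
  set QE := ∑ i, lE i * inner ℝ (fderiv ℝ (gradient (P.cE i)) x (v 2)) (x' - x) with hQE
  set QI := ∑ i, lI i * inner ℝ (fderiv ℝ (gradient (P.cI i)) x (v 2)) (x' - x) with hQI
  have hQE' : |QE| ≤ mE * (A * ‖x' - x‖ * ‖v‖) :=
    (Finset.abs_sum_le_sum_abs _ _).trans
      ((Finset.sum_le_sum fun i _ => hterm (hAE i)).trans (by simp))
  have hQI' : |QI| ≤ mI * (A * ‖x' - x‖ * ‖v‖) :=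
    (Finset.abs_sum_le_sum_abs _ _).trans
      ((Finset.sum_le_sum fun i _ => hterm (hAI i)).trans (by simp))
  have hge : inner ℝ (g + e) (v 0) = ∑ i, lE i * inner ℝ (gradient (P.cE i) x) (v 0)
      + ∑ i, lI i * inner ℝ (gradient (P.cI i) x) (v 0) := by
    rw [he, inner_add_left, sum_inner, sum_inner]
    simp only [inner_smul_left, RCLike.conj_to_real]
  -- By stationarity the gradients in the first component leave only −e; every other term contains
  -- x′ − x.
  have hTv : T v = -(inner ℝ (v 1) (x' - x)) + σ * inner ℝ (x' - x) (v 0)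
      + l * inner ℝ (x' - x) (v 0) - l * inner ℝ (x' - x) (v 2) - inner ℝ e (v 0) - QE - QI := by
    rw [hT' v]
    simp only [hTE', hTI', z0, z2, mul_add, Finset.sum_add_distrib]
    rw [← hQE, ← hQI]
    rw [inner_add_left] at hge
    simp only [inner_sub_left, inner_sub_right, inner_smul_left, RCLike.conj_to_real]
    linarith
  have b1 : |inner ℝ (v 1) (x' - x)| ≤ ‖x' - x‖ * ‖v‖ := by
    rw [real_inner_comm]
    exact (abs_real_inner_le_norm _ _).trans (mul_le_mul_of_nonneg_left (hcomp 1) (norm_nonneg _))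
  have b2 : ∀ i, |inner ℝ (x' - x) (v i)| ≤ ‖x' - x‖ * ‖v‖ := fun i =>
    (abs_real_inner_le_norm _ _).trans (mul_le_mul_of_nonneg_left (hcomp i) (norm_nonneg _))
  have b3 : |inner ℝ e (v 0)| ≤ ‖e‖ * ‖v‖ :=
    (abs_real_inner_le_norm _ _).trans (mul_le_mul_of_nonneg_left (hcomp 0) (norm_nonneg _))
  have b4 : ∀ (r : ℝ) i, |r * inner ℝ (x' - x) (v i)| ≤ |r| * (‖x' - x‖ * ‖v‖) := fun r i => by
    rw [abs_mul]; exact mul_le_mul_of_nonneg_left (b2 i) (abs_nonneg _)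
  have c1 := abs_le.1 b1
  have c2 := abs_le.1 (b4 σ 0)
  have c3 := abs_le.1 (b4 l 0)
  have c4 := abs_le.1 (b4 l 2)
  have c5 := abs_le.1 b3
  have c6 := abs_le.1 hQE'
  have c7 := abs_le.1 hQI'
  rw [Real.norm_eq_abs, hTv, abs_le]
  constructor <;> linarith

end Problem

/-! ### Convergence of the run -/

theorem contDiff_gradient {n : ℕ} {c : Sp n → ℝ} (hc : ContDiff ℝ 2 c) :
    ContDiff ℝ 1 (gradient c) :=
  (InnerProductSpace.toDual ℝ (Sp n)).symm.contDiff.comp (hc.fderiv_right (by norm_num))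

namespace SQPAssumptions

variable {n mE mI : ℕ} {P : Problem n mE mI} {D O : Set (Sp n)} {K : ℝ≥0}
    {ρ H η τ γ : ℝ} {s : Iterates n mE mI} {b c_b M : ℝ}

theorem tendsto_d (h : SQPAssumptions P D O K ρ H η τ γ s b c_b M) :
    Tendsto (fun k => ‖s.d k‖) atTop (𝓝 0) := by
  obtain ⟨Θ, hΘ⟩ := h.exists_theta_le
  obtain ⟨m, hm⟩ := h.exists_le_f
  obtain ⟨V, hV⟩ := h.isCompact.exists_bound_of_continuousOn h.continuous_violation.continuousOn
  obtain ⟨N, hN⟩ := eventually_atTop.1 h.eventually_full_step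
  have hV' : ∀ k, P.violation (s.x k) ≤ V := fun k => (le_abs_self _).trans (hV _ (h.mem k))
  have hV0 : 0 ≤ V := (violation_nonneg _).trans (hV' 0)
  -- The added term pays for penalty increases: raising θ lifts the merit function by at most the
  -- increase times V, and (Θ − θ)V falls by that amount.
  set E : ℕ → ℝ := fun k => P.merit (s.x k) (s.θ k) + (Θ - s.θ k) * V with hE
  have hc : 0 < (1 - c_b) / 2 * b := mul_pos (by linarith [h.cb_lt]) h.b_pos
  have hstep : ∀ k ≥ N, (1 - c_b) / 2 * b * ‖s.d k‖ ^ 2 ≤ E k - E (k + 1) := fun k hk => by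
    have h1 := (hN k hk).2.2
    have h2 := mul_le_mul_of_nonneg_left (h.le_inner_B k) (by linarith [h.cb_lt] : 0 ≤ (1 - c_b) / 2)
    have h3 := mul_le_mul_of_nonneg_left (hV' (k + 1))
      (sub_nonneg.2 (h.monotone_theta (Nat.le_succ k)))
    simp only [hE, Problem.merit] at h1 ⊢
    simp only [Nat.succ_eq_add_one] at h3
    linarith
  have hanti : Antitone fun k => E (k + N) := antitone_nat_of_succ_le fun k => by
    have h1 := hstep (k + N) (by omega)
    have h2 := mul_nonneg hc.le (sq_nonneg ‖s.d (k + N)‖)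
    rw [show k + 1 + N = k + N + 1 by omega]
    linarith
  have hbdd : BddBelow (range fun k => E (k + N)) := ⟨m, by
    rintro _ ⟨k, rfl⟩
    have h1 := (hm _ (h.mem (k + N))).1
    have h2 := mul_nonneg (h.theta_pos (k + N)).le (violation_nonneg (P := P) (s.x (k + N)))
    have h3 := mul_nonneg (sub_nonneg.2 (hΘ (k + N))) hV0
    simp only [hE, Problem.merit]
    linarith⟩
  obtain ⟨L, hL⟩ : ∃ L, Tendsto E atTop (𝓝 L) :=
    ⟨_, (tendsto_add_atTop_iff_nat N).1 (tendsto_atTop_ciInf hanti hbdd)⟩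
  have hdiff : Tendsto (fun k => (E k - E (k + 1)) / ((1 - c_b) / 2 * b)) atTop (𝓝 0) := by
    simpa using (hL.sub (hL.comp (tendsto_add_atTop_nat 1))).div_const ((1 - c_b) / 2 * b)
  have hsq : Tendsto (fun k => ‖s.d k‖ ^ 2) atTop (𝓝 0) := by
    refine squeeze_zero' (Eventually.of_forall fun k => sq_nonneg _) ?_ hdiff
    filter_upwards [eventually_ge_atTop N] with k hk
    rw [le_div_iff₀ hc, mul_comm]
    exact hstep k hk
  simpa using hsq.sqrt

/-- Eventually the linearized constraints are consistent and the slack variables vanish. -/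
theorem eventually_slack_eq_zero (h : SQPAssumptions P D O K ρ H η τ γ s b c_b M) :
    ∀ᶠ k in atTop, s.v k = 0 ∧ s.w k = 0 ∧ s.t k = 0 := by
  obtain ⟨Θ, hΘ⟩ := h.exists_theta_le
  obtain ⟨T, hT⟩ : ∃ T, Tendsto s.θ atTop (𝓝 T) :=
    ⟨_, tendsto_atTop_ciSup h.monotone_theta ⟨Θ, by rintro _ ⟨k, rfl⟩; exact hΘ k⟩⟩
  have hdiff : Tendsto (fun k => s.θ (k + 1) - s.θ k) atTop (𝓝 0) := by
    simpa using (hT.comp (tendsto_add_atTop_nat 1)).sub hT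
  -- An increment below γ means ‖λ‖∞ < θ_k strictly, so all bound multipliers of the slacks are
  -- positive and complementarity makes the slacks zero.
  filter_upwards [hdiff.eventually_lt_const h.gamma_pos] with k hk
  have h1 : max ‖s.lE k‖ ‖s.lI k‖ < s.θ k := by
    have := h.run.penalty k
    linarith [le_max_right (s.θ k) (max ‖s.lE k‖ ‖s.lI k‖ + γ)]
  have hE : ∀ i, |s.lE k i| < s.θ k := fun i =>
    (norm_le_pi_norm (s.lE k) i).trans_lt ((le_max_left _ _).trans_lt h1)
  have hI : ∀ i, |s.lI k i| < s.θ k := fun i =>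
    (norm_le_pi_norm (s.lI k) i).trans_lt ((le_max_right _ _).trans_lt h1)
  refine ⟨funext fun i => ?_, funext fun i => ?_, funext fun i => ?_⟩
  · have h2 := ((h.run.multiplier k).lE_mul i).1
    have h3 : (s.lE k i + s.θ k) * s.v k i = 0 := by linarith
    exact (mul_eq_zero.1 h3).resolve_left (by linarith [(abs_lt.1 (hE i)).1])
  · have h2 := ((h.run.multiplier k).lE_mul i).2
    have h3 : (s.θ k - s.lE k i) * s.w k i = 0 := by linarith
    exact (mul_eq_zero.1 h3).resolve_left (by linarith [(abs_lt.1 (hE i)).2])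
  · have h2 := (h.run.multiplier k).lI_mul i
    have h3 : (s.θ k - s.lI k i) * s.t k i = 0 := by linarith
    exact (mul_eq_zero.1 h3).resolve_left (by linarith [(abs_lt.1 (hI i)).2])

theorem eventually_linFeasible (h : SQPAssumptions P D O K ρ H η τ γ s b c_b M) :
    ∀ᶠ k in atTop, (s.x k + s.d k, s.x k) ∈ P.linFeasible ∧
      ∀ i, s.lI k i * Problem.linearized (P.cI i) (s.x k + s.d k) (s.x k) = 0 := by
  filter_upwards [h.eventually_slack_eq_zero] with k hk
  obtain ⟨h1, h2, h3⟩ := hk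
  obtain ⟨f1, f2, -⟩ := (h.run.solution k).1
  have f3 := (h.run.multiplier k).2.1
  rw [h1, h2] at f1
  rw [h3] at f2 f3
  simp only [Pi.zero_apply, neg_zero, add_zero, sub_zero] at f1 f2 f3
  refine ⟨⟨fun i => ?_, fun i => ?_⟩, fun i => ?_⟩ <;>
    simp only [Problem.linearized, add_sub_cancel_left]
  exacts [f1 i, f2 i, f3 i]

/-- Limits of iterates and subgradients satisfy the KKT conditions. -/
theorem kkt_of_subseq (h : SQPAssumptions P D O K ρ H η τ γ s b c_b M) {φ : ℕ → ℕ}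
    (hφ : StrictMono φ) {x g : Sp n} (hx : Tendsto (s.x ∘ φ) atTop (𝓝 x))
    (hg : Tendsto (s.g ∘ φ) atTop (𝓝 g)) :
    x ∈ D ∧ g ∈ clarkeSubdiff P.f x ∧ (∀ i, P.cE i x = 0) ∧ (∀ i, 0 ≤ P.cI i x) ∧
      ∃ (lE : Fin mE → ℝ) (lI : Fin mI → ℝ),
        g = ∑ i, lE i • gradient (P.cE i) x + ∑ i, lI i • gradient (P.cI i) x ∧
        (∀ i, 0 ≤ lI i) ∧ ∀ i, lI i * P.cI i x = 0 := by
  obtain ⟨Θ, hΘ⟩ := h.exists_theta_le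
  have hΘ0 : 0 ≤ Θ := (h.theta_pos 0).le.trans (hΘ 0)
  set q : ℕ → (Fin mE → ℝ) × (Fin mI → ℝ) := fun k => (s.lE k, s.lI k) with hq
  have hqc : ∀ k, (q ∘ φ) k ∈ Metric.closedBall (0 : Fin mE → ℝ) Θ ×ˢ
      Metric.closedBall (0 : Fin mI → ℝ) Θ := fun k => by
    refine ⟨?_, ?_⟩ <;> rw [mem_closedBall_zero_iff, pi_norm_le_iff_of_nonneg hΘ0] <;> intro i
    · exact ((h.run.multiplier _).abs_lE_le i).trans (hΘ _)
    · exact (Real.norm_of_nonneg ((h.run.multiplier _).lI_nonneg i)).le.trans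
        (((h.run.multiplier _).lI_le i).trans (hΘ _))
  obtain ⟨⟨lE, lI⟩, -, ψ, hψ, hlim⟩ := ((isCompact_closedBall _ _).prod
    (isCompact_closedBall _ _)).tendsto_subseq hqc
  set χ := φ ∘ ψ with hχ
  have hχm : StrictMono χ := hφ.comp hψ
  have hχt := hχm.tendsto_atTop
  have tx : Tendsto (s.x ∘ χ) atTop (𝓝 x) := hx.comp hψ.tendsto_atTop
  have tg : Tendsto (s.g ∘ χ) atTop (𝓝 g) := hg.comp hψ.tendsto_atTop
  have tE : Tendsto (s.lE ∘ χ) atTop (𝓝 lE) := (continuous_fst.tendsto _).comp hlim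
  have tI : Tendsto (s.lI ∘ χ) atTop (𝓝 lI) := (continuous_snd.tendsto _).comp hlim
  have td : Tendsto (s.d ∘ χ) atTop (𝓝 0) :=
    (tendsto_zero_iff_norm_tendsto_zero.2 h.tendsto_d).comp hχt
  have tB : Tendsto (fun k => s.B (χ k) (s.d (χ k))) atTop (𝓝 0) :=
    squeeze_zero_norm (fun k => h.norm_B_apply_le (χ k))
      (by simpa using (h.tendsto_d.comp hχt).const_mul M)
  have tlin : ∀ {c : Sp n → ℝ}, ContDiff ℝ 2 c →
      Tendsto (fun k => Problem.linearized c (s.x (χ k) + s.d (χ k)) (s.x (χ k))) atTop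
        (𝓝 (c x)) := fun {c} hc => by
    have h1 := ((hc.continuous.tendsto x).comp tx).add
      ((((continuous_gradient_of_contDiff hc).tendsto x).comp tx).inner (𝕜 := ℝ) td)
    simp only [inner_zero_right, add_zero] at h1
    simpa [Problem.linearized, Function.comp_def] using h1
  have hev := hχt.eventually h.eventually_linFeasible
  refine ⟨h.isCompact.isClosed.mem_of_tendsto tx (Eventually.of_forall fun k => h.mem _),
    clarkeSubdiff.mem_of_tendsto tx tg fun k => h.run.subgradient _, fun i => ?_, fun i => ?_,
    lE, lI, ?_, fun i => ?_, fun i => ?_⟩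
  · exact tendsto_nhds_unique_of_eventuallyEq (tlin (h.contDiff_cE i)) tendsto_const_nhds
      (hev.mono fun k hk => hk.1.1 i)
  · exact ge_of_tendsto (tlin (h.contDiff_cI i)) (hev.mono fun k hk => hk.1.2 i)
  · have h1 := tg.add tB
    rw [add_zero] at h1
    refine tendsto_nhds_unique (h1.congr fun k => ?_)
      ((tendsto_sum_smul_gradient h.contDiff_cE tx tE).add
        (tendsto_sum_smul_gradient h.contDiff_cI tx tI))
    exact sub_eq_zero.1 (h.run.multiplier (χ k)).1
  · exact ge_of_tendsto' (tendsto_pi_nhds.1 tI i) fun k => (h.run.multiplier _).lI_nonneg i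
  · exact tendsto_nhds_unique_of_eventuallyEq
      ((tendsto_pi_nhds.1 tI i).mul (tlin (h.contDiff_cI i))) tendsto_const_nhds
      (hev.mono fun k hk => hk.2 i)

theorem f_le_of_mem_clarkeSubdiff (h : SQPAssumptions P D O K ρ H η τ γ s b c_b M) {σ : ℝ}
    (hσ : ρ ≤ σ) {x g : Sp n} (hx : x ∈ D) (hg : g ∈ clarkeSubdiff P.f x) :
    ∀ y ∈ D, P.f y ≤ P.f x + inner ℝ g (y - x) + σ / 2 * ‖y - x‖ ^ 2 := fun y hy => by
  have := clarkeSubdiff.le_add_of_convexOn h.isOpen h.subset h.upperC2 h.continuousOn_f h.convexOn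
    hx hy hg
  nlinarith [mul_le_mul_of_nonneg_right hσ (sq_nonneg ‖y - x‖)]

/-- Sufficient decrease of the potential function. -/
theorem eventually_potential_decrease (h : SQPAssumptions P D O K ρ H η τ γ s b c_b M) {σ l : ℝ}
    (hσ : ρ ≤ σ) (h2b : l + σ ≤ 2 * b) :
    ∀ᶠ k in atTop, (l - c_b * b) / 2 * ‖s.d k‖ ^ 2 ≤
      (P.f (s.x k) + inner ℝ (s.g k) (s.d k) + (σ + l) / 2 * ‖s.d k‖ ^ 2) -
      (P.f (s.x (k + 1)) + inner ℝ (s.g (k + 1)) (s.d (k + 1))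
        + (σ + l) / 2 * ‖s.d (k + 1)‖ ^ 2) := by
  filter_upwards [h.eventually_full_step, h.eventually_slack_eq_zero,
    (tendsto_add_atTop_nat 1).eventually h.eventually_slack_eq_zero,
    (tendsto_add_atTop_nat 1).eventually h.theta_le] with k h1 ⟨h2, h2', h2''⟩ ⟨h3, h3', h3''⟩ h4
  -- The upper model bounds the potential at k below by f(x_{k+1}) + (l/2)‖d_k‖². At k + 1,
  -- stationarity gives ⟨g, d⟩ ≤ −b‖d‖² + θ·violation, where the violation is only the linearization
  -- error of step k. The condition 2b ≥ l + σ absorbs ‖d_{k+1}‖².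
  have e1 := h.f_le_of_mem_clarkeSubdiff hσ (h.mem k) (h.run.subgradient k) _ (h.add_mem k)
  rw [add_sub_cancel_left, ← h1.2.1] at e1
  have e2 := (h.run.multiplier (k + 1)).inner_add_eq (h.run.solution (k + 1)).1
  have e3 := (h.run.multiplier (k + 1)).neg_violation_le (s.x (k + 1))
  have e4 := Problem.violation_add_le h.abs_cE h.abs_cI (h.mem k) (h.add_mem k)
    (h.run.solution k).1
  rw [h3, h3', h3''] at e2
  rw [h2, h2', h2'', ← h1.2.1] at e4
  simp only [Pi.zero_apply, add_zero, Finset.sum_const_zero, mul_zero, neg_zero, zero_add] at e2 e4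
  have e5 := mul_le_mul_of_nonneg_left e4 (h.theta_pos (k + 1)).le
  have e6 := mul_le_mul_of_nonneg_right h4 (sq_nonneg ‖s.d k‖)
  have e7 := h.le_inner_B (k + 1)
  have e8 := mul_le_mul_of_nonneg_right h2b (sq_nonneg ‖s.d (k + 1)‖)
  linarith

theorem exists_mul_norm_fderiv_gradient_le (h : SQPAssumptions P D O K ρ H η τ γ s b c_b M) :
    ∃ A : ℝ, 0 ≤ A ∧ ∀ x ∈ D, (∀ i, ‖fderiv ℝ (gradient (P.cE i)) x‖ ≤ A) ∧
      ∀ i, ‖fderiv ℝ (gradient (P.cI i)) x‖ ≤ A := by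
  have hc : Continuous fun x => ∑ i, ‖fderiv ℝ (gradient (P.cE i)) x‖
      + ∑ i, ‖fderiv ℝ (gradient (P.cI i)) x‖ :=
    (continuous_finsetSum _ fun i _ =>
      ((contDiff_gradient (h.contDiff_cE i)).continuous_fderiv (by norm_num)).norm).add
    (continuous_finsetSum _ fun i _ =>
      ((contDiff_gradient (h.contDiff_cI i)).continuous_fderiv (by norm_num)).norm)
  obtain ⟨A, hA⟩ := h.isCompact.exists_bound_of_continuousOn hc.continuousOn
  refine ⟨A, (norm_nonneg _).trans (hA _ (h.mem 0)), fun x hx => ⟨fun i => ?_, fun i => ?_⟩⟩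
  · refine le_trans ?_ ((le_abs_self _).trans (hA x hx))
    have h1 := Finset.single_le_sum (f := fun i => ‖fderiv ℝ (gradient (P.cE i)) x‖)
      (fun i _ => norm_nonneg _) (Finset.mem_univ i)
    have h2 : 0 ≤ ∑ i, ‖fderiv ℝ (gradient (P.cI i)) x‖ :=
      Finset.sum_nonneg fun i _ => norm_nonneg _
    linarith
  · refine le_trans ?_ ((le_abs_self _).trans (hA x hx))
    have h1 := Finset.single_le_sum (f := fun i => ‖fderiv ℝ (gradient (P.cI i)) x‖)
      (fun i _ => norm_nonneg _) (Finset.mem_univ i)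
    have h2 : 0 ≤ ∑ i, ‖fderiv ℝ (gradient (P.cE i)) x‖ :=
      Finset.sum_nonneg fun i _ => norm_nonneg _
    linarith

/-- The steps have finite total length. -/
theorem summable_norm_d (h : SQPAssumptions P D O K ρ H η τ γ s b c_b M) {σ l : ℝ}
    (hσ : ρ ≤ σ) (h2b : l + σ ≤ 2 * b) (hlb : b < l / c_b)
    (hKL : IsKLFunction (P.potential D σ l)) : Summable fun k => ‖s.d k‖ := by
  obtain ⟨Θ, hΘ⟩ := h.exists_theta_le
  have hΘ0 : 0 ≤ Θ := (h.theta_pos 0).le.trans (hΘ 0)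
  obtain ⟨A, hA0, hA⟩ := h.exists_mul_norm_fderiv_gradient_le
  obtain ⟨m, hm⟩ := h.exists_le_f
  obtain ⟨R, hR⟩ := h.exists_norm_d_le
  obtain ⟨R', hR'⟩ := h.isCompact.isBounded.exists_norm_le
  have hM : 0 ≤ M := (norm_nonneg _).trans (h.norm_B_le 0)
  rw [lt_div_iff₀ h.cb_pos] at hlb
  have hl : 0 < l := (mul_pos h.b_pos h.cb_pos).trans hlb
  have hσ0 : 0 < σ := h.rho_pos.trans_le hσ
  obtain ⟨N, hN⟩ := eventually_atTop.1
    (h.eventually_linFeasible.and (h.eventually_potential_decrease hσ h2b))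
  refine (summable_nat_add_iff N).1 ?_
  set ℓ : ℕ → ℝ := fun k => P.f (s.x k) + inner ℝ (s.g k) (s.d k) + (σ + l) / 2 * ‖s.d k‖ ^ 2
    with hℓ
  set z : ℕ → PiLp 2 (fun _ : Fin 3 => Sp n) := fun k =>
    WithLp.toLp 2 ![s.x k + s.d k, σ • s.x k - s.g k, s.x k] with hz
  have ha : 0 < (l - c_b * b) / 2 := by linarith
  have hval : ∀ k ≥ N, P.potential D σ l (z k) = ℓ k := fun k hk => by
    rw [hz, Problem.potential_eq (h.mem k)
      (h.f_le_of_mem_clarkeSubdiff hσ (h.mem k) (h.run.subgradient k)) (hN k hk).1.1,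
      add_sub_cancel_left]
  -- Stationarity of the subproblem is used with e = B_k d_k, whose norm is at most M‖d_k‖.
  have hsub : ∀ k ≥ N, ∃ u ∈ limSubdiff (P.potential D σ l) (z k),
      ‖u‖ ≤ (1 + |σ| + 2 * |l| + (mE + mI) * (Θ * A) + M) * ‖s.d k‖ := fun k hk => by
    obtain ⟨u, hu, hu'⟩ := Problem.exists_mem_limSubdiff_potential (l := l) (h.mem k)
      (h.f_le_of_mem_clarkeSubdiff hσ (h.mem k) (h.run.subgradient k)) (hN k hk).1.1
      h.contDiff_cE h.contDiff_cI (h.run.multiplier k).lI_nonneg (hN k hk).1.2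
      (sub_eq_zero.1 (h.run.multiplier k).1) (mul_nonneg hΘ0 hA0)
      (fun i => mul_le_mul (((h.run.multiplier k).abs_lE_le i).trans (hΘ k))
        ((hA _ (h.mem k)).1 i) (norm_nonneg _) hΘ0)
      (fun i => mul_le_mul ((abs_of_nonneg ((h.run.multiplier k).lI_nonneg i)).le.trans
        (((h.run.multiplier k).lI_le i).trans (hΘ k))) ((hA _ (h.mem k)).2 i) (norm_nonneg _) hΘ0)
    refine ⟨u, hu, hu'.trans ?_⟩
    rw [add_sub_cancel_left]
    linarith [h.norm_B_apply_le k]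
  have hbd : Bornology.IsBounded (range fun k => z (k + N)) := by
    refine isBounded_iff_forall_norm_le.2 ⟨R' + (σ * R' + K) + R', ?_⟩
    rintro _ ⟨k, rfl⟩
    have n0 := hR' _ (h.add_mem (k + N))
    have n2 := hR' _ (h.mem (k + N))
    have n1 : ‖σ • s.x (k + N) - s.g (k + N)‖ ≤ σ * R' + K := by
      refine (norm_sub_le _ _).trans (add_le_add ?_ (h.norm_g_le _))
      rw [norm_smul, Real.norm_of_nonneg hσ0.le]
      exact mul_le_mul_of_nonneg_left n2 hσ0.le
    have p0 := norm_nonneg (s.x (k + N) + s.d (k + N))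
    have p1 := norm_nonneg (σ • s.x (k + N) - s.g (k + N))
    have p2 := norm_nonneg (s.x (k + N))
    refine le_trans (abs_le_of_sq_le_sq' (b := ‖s.x (k + N) + s.d (k + N)‖ +
      ‖σ • s.x (k + N) - s.g (k + N)‖ + ‖s.x (k + N)‖) ?_ (by positivity)).2 (by linarith)
    rw [PiLp.norm_sq_eq_of_L2, Fin.sum_univ_three]
    simp only [hz, Matrix.cons_val_zero, Matrix.cons_val_one, Matrix.cons_val]
    nlinarith [mul_nonneg p0 p1, mul_nonneg p0 p2, mul_nonneg p1 p2]
  have hanti : Antitone fun k => ℓ (k + N) := antitone_nat_of_succ_le fun k => by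
    have h1 := (hN (k + N) (by omega)).2
    have h2 := mul_nonneg ha.le (sq_nonneg ‖s.d (k + N)‖)
    rw [show k + 1 + N = k + N + 1 by omega]
    simp only [hℓ]
    linarith
  have hginner : ∀ k, |inner ℝ (s.g k) (s.d k)| ≤ K * ‖s.d k‖ := fun k =>
    (abs_real_inner_le_norm _ _).trans
      (mul_le_mul_of_nonneg_right (h.norm_g_le k) (norm_nonneg _))
  have hbdd : BddBelow (range fun k => ℓ (k + N)) := ⟨m - K * R, by
    rintro _ ⟨k, rfl⟩
    have h1 := (hm _ (h.mem (k + N))).1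
    have h2 := (abs_le.1 (hginner (k + N))).1
    have h3 := mul_le_mul_of_nonneg_left (hR (k + N)) K.coe_nonneg
    have h4 : 0 ≤ (σ + l) / 2 * ‖s.d (k + N)‖ ^ 2 := by positivity
    simp only [hℓ]
    linarith⟩
  have hlim := tendsto_atTop_ciInf hanti hbdd
  refine summable_of_KLPropertyAt (h := P.potential D σ l) hbd
    (fun k => hval (k + N) (by omega)) (fun k => norm_nonneg _) ha (fun k => ?_)
    (by positivity) (fun k => hsub (k + N) (by omega)) hlim fun y hy => ?_
  · have := (hN (k + N) (by omega)).2
    rwa [show k + N + 1 = k + 1 + N by omega] at this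
  obtain ⟨φ, hφ, hφy⟩ := hy.tendsto_subseq
  set χ : ℕ → ℕ := fun k => φ k + N with hχ
  have hχm : StrictMono χ := fun i j hij => Nat.add_lt_add_right (hφ hij) N
  have tcomp : ∀ i, Tendsto (fun k => z (χ k) i) atTop (𝓝 (y i)) := fun i =>
    (((PiLp.proj (𝕜 := ℝ) 2 (fun _ : Fin 3 => Sp n) i).continuous).tendsto y).comp hφy
  have tx : Tendsto (s.x ∘ χ) atTop (𝓝 (y 2)) := tcomp 2
  have ty : Tendsto (fun k => σ • s.x (χ k) - s.g (χ k)) atTop (𝓝 (y 1)) := tcomp 1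
  have tw : Tendsto (fun k => s.x (χ k) + s.d (χ k)) atTop (𝓝 (y 0)) := tcomp 0
  have tn : Tendsto (fun k => ‖s.d (χ k)‖) atTop (𝓝 0) := h.tendsto_d.comp hχm.tendsto_atTop
  have td : Tendsto (fun k => s.d (χ k)) atTop (𝓝 0) := tendsto_zero_iff_norm_tendsto_zero.2 tn
  have h02 : y 0 = y 2 := tendsto_nhds_unique tw (by simpa using tx.add td)
  have tg : Tendsto (s.g ∘ χ) atTop (𝓝 (σ • y 2 - y 1)) :=
    ((tx.const_smul σ).sub ty).congr fun k => by simp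
  obtain ⟨hyD, hgC, hcE, hcI, lE, lI, hsum, hlI, hcompl⟩ := h.kkt_of_subseq hχm tx tg
  -- As d_k → 0, cluster points have the form (x, σx − g, x) with g a Clarke subgradient and x a KKT
  -- point. The potential there is f(x), the common limit value.
  have hyeq : y = WithLp.toLp 2 ![y 2, σ • y 2 - (σ • y 2 - y 1), y 2] := by
    refine PiLp.ext fun i => ?_
    fin_cases i
    · exact h02
    · simp
    · rfl
  have hlin : (y 2, y 2) ∈ P.linFeasible :=
    ⟨fun i => by simp [Problem.linearized, hcE i], fun i => by simp [Problem.linearized, hcI i]⟩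
  have hsup := h.f_le_of_mem_clarkeSubdiff hσ hyD hgC
  have hpot : P.potential D σ l y = (P.f (y 2) : EReal) := by
    rw [hyeq, Problem.potential_eq hyD hsup hlin]
    simp
  constructor
  · rw [hpot, EReal.coe_eq_coe_iff]
    refine tendsto_nhds_unique ?_ (hlim.comp hφ.tendsto_atTop)
    have h1 : Tendsto (fun k => P.f (s.x (χ k))) atTop (𝓝 (P.f (y 2))) :=
      ((h.continuousOn_f.continuousAt (h.isOpen.mem_nhds (h.subset hyD))).tendsto).comp tx
    have h2 : Tendsto (fun k => inner ℝ (s.g (χ k)) (s.d (χ k))) atTop (𝓝 0) :=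
      squeeze_zero_norm (fun k => hginner (χ k)) (by simpa using tn.const_mul (K : ℝ))
    simpa [hℓ, hχ, Function.comp_def] using (h1.add h2).add ((tn.pow 2).const_mul ((σ + l) / 2))
  · refine hKL y ?_
    -- The KKT multipliers, with x′ = x and e = 0, supply a subgradient at y, so y lies where the KL
    -- property is assumed.
    obtain ⟨u, hu, -⟩ := Problem.exists_mem_limSubdiff_potential (P := P) (l := l) (e := 0)
      hyD hsup hlin
      h.contDiff_cE h.contDiff_cI hlI (fun i => by simpa [Problem.linearized] using hcompl i)
      (by rw [add_zero]; exact hsum)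
      (A := (∑ i, |lE i| + ∑ i, |lI i|) * A)
      (mul_nonneg (add_nonneg (Finset.sum_nonneg fun _ _ => abs_nonneg _)
        (Finset.sum_nonneg fun _ _ => abs_nonneg _)) hA0)
      (fun i => mul_le_mul (le_add_of_le_of_nonneg
        (Finset.single_le_sum (f := fun i => |lE i|) (fun _ _ => abs_nonneg _) (Finset.mem_univ i))
        (Finset.sum_nonneg fun _ _ => abs_nonneg _)) ((hA _ hyD).1 i) (norm_nonneg _)
        (add_nonneg (Finset.sum_nonneg fun _ _ => abs_nonneg _)
          (Finset.sum_nonneg fun _ _ => abs_nonneg _)))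
      (fun i => mul_le_mul (le_add_of_nonneg_of_le
        (Finset.sum_nonneg fun _ _ => abs_nonneg _)
        (Finset.single_le_sum (f := fun i => |lI i|) (fun _ _ => abs_nonneg _)
          (Finset.mem_univ i))) ((hA _ hyD).2 i) (norm_nonneg _)
        (add_nonneg (Finset.sum_nonneg fun _ _ => abs_nonneg _)
          (Finset.sum_nonneg fun _ _ => abs_nonneg _)))
    rw [← hyeq] at hu
    exact ⟨u, hu⟩

theorem exists_tendsto_isKKT (h : SQPAssumptions P D O K ρ H η τ γ s b c_b M) {σ l : ℝ}
    (hσ : ρ ≤ σ) (h2b : l + σ ≤ 2 * b) (hlb : b < l / c_b)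
    (hKL : IsKLFunction (P.potential D σ l)) :
    ∃ x, P.IsKKT x ∧ Tendsto s.x atTop (𝓝 x) := by
  have hsum := h.summable_norm_d hσ h2b hlb hKL
  obtain ⟨N, hN⟩ := eventually_atTop.1 h.eventually_full_step
  have hcau : CauchySeq fun k => s.x (k + N) := by
    refine cauchySeq_of_summable_dist (((summable_nat_add_iff N).2 hsum).congr fun k => ?_)
    rw [Nat.succ_eq_add_one, show k + 1 + N = k + N + 1 by omega, (hN (k + N) (by omega)).2.1,
      dist_self_add_right]
  obtain ⟨x, hx⟩ := cauchySeq_tendsto_of_complete hcau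
  have hx := (tendsto_add_atTop_iff_nat N).1 hx
  -- The subgradients g_k need not converge; a convergent subsequence suffices, since the limit of
  -- the iterates is already known.
  obtain ⟨g, -, φ, hφ, hg⟩ := (isCompact_closedBall (0 : Sp n) K).tendsto_subseq
    (x := s.g) fun k => mem_closedBall_zero_iff.2 (h.norm_g_le k)
  obtain ⟨-, hgC, hcE, hcI, lE, lI, hs, hlI, hcompl⟩ :=
    h.kkt_of_subseq hφ (hx.comp hφ.tendsto_atTop) hg
  exact ⟨x, ⟨lE, lI, ⟨g, hgC, sub_eq_zero.2 hs⟩, hcE, fun i => ⟨hcompl i, hcI i⟩, hlI⟩, hx⟩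

end SQPAssumptions

theorem mainTheorem5 {n mE mI : ℕ} (P : Problem n mE mI)
    -- the compact convex set `D`, and the objective near it
    (D O : Set (Sp n)) (hO : IsOpen O) (hDO : D ⊆ O)
    (hDconv : Convex ℝ D) (hDcomp : IsCompact D) (hΩD : P.feasibleSet ⊆ D)
    (K : ℝ≥0) (hLip : LipschitzOnWith K P.f O) (hC2 : UpperC2On P.f O)
    (ρ : ℝ) (hρ : 0 < ρ) (hρconv : ConvexOn ℝ D (fun x => -(P.f x) + 1 / 2 * ρ * ‖x‖ ^ 2))
    -- the constraints
    (hcE : ∀ i, ContDiff ℝ 2 (P.cE i)) (hcI : ∀ i, ContDiff ℝ 2 (P.cI i))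
    (H : ℝ) (hH : 0 ≤ H)
    (hHE : ∀ i, ∀ x ∈ D, ∀ x' ∈ D,
      |P.cE i x' - P.cE i x - inner ℝ (gradient (P.cE i) x) (x' - x)| ≤ H / 2 * ‖x - x'‖ ^ 2)
    (hHI : ∀ i, ∀ x ∈ D, ∀ x' ∈ D,
      |P.cI i x' - P.cI i x - inner ℝ (gradient (P.cI i) x) (x' - x)| ≤ H / 2 * ‖x - x'‖ ^ 2)
    -- the run of the algorithm
    (η τ γ : ℝ) (hη : 0 < η) (hη1 : η < 1) (hτ : 0 < τ) (hτ1 : τ < 1) (hγ : 0 < γ)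
    (s : Iterates n mE mI) (hrun : IsSQPRun P η τ γ s)
    (hxD : ∀ k, s.x k ∈ D) (hxdD : ∀ k, s.x k + s.d k ∈ D)
    (hBsymm : ∀ k, IsSelfAdjoint (s.B k)) (hBbdd : ∃ M : ℝ, ∀ k, ‖s.B k‖ ≤ M)
    (b : ℝ) (hBpos : ∀ k, ∀ d : Sp n, b * ‖d‖ ^ 2 ≤ inner ℝ d (s.B k d))
    (hMFCQ : ∀ x' : Sp n, MapClusterPt x' atTop s.x → P.MFCQ x')
    -- the constants and the KL assumption
    (σ l c_b : ℝ) (hcb : 0 < c_b) (hcb1 : c_b < 1) (hηcb : η ≤ 1 - c_b)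
    (hBc : ∀ᶠ k in atTop, s.θ k * (((mE + mI : ℕ) : ℝ) * H) ≤ c_b * b)
    (h2b : l + σ ≤ 2 * b) (hlb : b < l / c_b) (hbσ : σ ≤ b) (hσρ : ρ ≤ σ)
    (hKL : IsKLFunction (P.potential D σ l)) :
    (∃ x' : Sp n, P.IsKKT x' ∧ Tendsto s.x atTop (𝓝 x')) ∧
      ∀ᶠ k in atTop, s.α k = 1 := by
  obtain ⟨M, hM⟩ := hBbdd
  have h : SQPAssumptions P D O K ρ H η τ γ s b c_b M :=
    { isOpen := hO, subset := hDO, isCompact := hDcomp, lipschitz := hLip, upperC2 := hC2,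
      convexOn := hρconv, rho_pos := hρ, contDiff_cE := hcE, contDiff_cI := hcI, H_nonneg := hH,
      abs_cE := hHE, abs_cI := hHI, gamma_pos := hγ, run := hrun, mem := hxD, add_mem := hxdD,
      norm_B_le := hM, le_B := hBpos, mfcq := hMFCQ, cb_pos := hcb, cb_lt := hcb1,
      eta_le := hηcb, theta_le := hBc, rho_le := hσρ.trans hbσ }
  exact ⟨h.exists_tendsto_isKKT hσρ h2b hlb hKL, h.eventually_full_step.mono fun _ hk => hk.1⟩
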